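/- Consider the $n$-round partial commitment repeated sales game: a buyer's private value $v$ is drawn once from $U[0,1]$; in each of the $n$ rounds the seller posts a non-negative price for a fresh copy of a perishable item (production cost $0$), which may not exceed any price that the buyer accepted in an earlier round, and the buyer accepts or rejects; utilities are quasilinear and undiscounted. A perfect Bayesian equilibrium (PBE) consists of a seller strategy, a buyer strategy and beliefs of the seller about $v$ after every history, starting from $U[0,1]$, such that the beliefs follow Bayes' rule after every reaction of the buyer that has positive probability, and after every history the seller's strategy (given his belief) and the strategy of every type of the buyer are best responses to each other; it is a threshold PBE if, after every history and posted price, the buyer accepts exactly when $v$ is at least a deterministic threshold. Let $R_0=0$ and $R_n=\dfrac{(1+2R_{n-1})^2}{4(1+R_{n-1})}$ for $n\ge 1$. Then for every $n\ge 1$ the game has a threshold PBE whose expected revenue is $R_n$, and $$R_n=\sqrt{\frac n2+\frac{\log n}{8}+O(1)}\;-\;1 .$$ Moreover these equilibria can be chosen such that the seller posts a deterministic first-round price $p_n$ with $p_n\sim\sqrt{2/n}$, and the buyer's first-round threshold $t_n$ at this price satisfies $1-t_n\sim \frac{1}{\sqrt{2n}}$, as $n\to\infty$. -/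

import Mathlib

open MeasureTheory ProbabilityTheory Filter Asymptotics
open scoped NNReal ENNReal Topology

namespace RepeatedSales

/-- A history of `k` completed rounds: for every round, the posted (non-negative) price and the
buyer's reaction (`true` = accept, `false` = reject). -/
abbrev Hist (k : ℕ) : Type := Fin k → ℝ≥0 × Bool

/-- The history before the first round. -/
def Hist.root : Hist 0 := Fin.elim0

/-- The history `h` followed by one more round with price `p` and reaction `b`. -/
def Hist.extend {k : ℕ} (h : Hist k) (p : ℝ≥0) (b : Bool) : Hist (k + 1) := Fin.snoc h (p, b)

/-- Partial commitment: after `h` the seller may post `p` only if `p` does not exceed any price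
that was accepted in `h`. -/
def Allowed {k : ℕ} (h : Hist k) (p : ℝ≥0) : Prop := ∀ i, (h i).2 = true → p ≤ (h i).1

/-- The histories that can occur in the partial commitment game: no price is higher than a price
that was accepted before. -/
def Legal {k : ℕ} (h : Hist k) : Prop := ∀ i j, i < j → (h i).2 = true → (h j).1 ≤ (h i).1

/-- A (behavioural, possibly randomized) strategy of the seller in the partial commitment game:
for every history a probability distribution over the non-negative prices that the seller may
post, measurable in the history. -/
structure SellerStrategy where
  price : ∀ k, Kernel (Hist k) ℝ≥0
  markov : ∀ k, IsMarkovKernel (price k)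
  noRaise : ∀ k (h : Hist k), ∀ᵐ p ∂(price k h), Allowed h p

/-- A (behavioural, possibly randomized) strategy of the buyer: `accept k v h p` is the
probability with which the buyer of value `v` accepts the price `p` posted after `h`. -/
structure BuyerStrategy where
  accept : ∀ k, ℝ → Hist k → ℝ≥0 → ℝ≥0∞
  accept_le_one : ∀ k v h p, accept k v h p ≤ 1
  measurable_accept : ∀ k,
    Measurable (fun x : ℝ × Hist k × ℝ≥0 => accept k x.1 x.2.1 x.2.2)

/-- The probability of the reaction `b` of the buyer of value `v` to the price `p` after `h`. -/
def BuyerStrategy.prob (B : BuyerStrategy) {k : ℕ} (b : Bool) (v : ℝ) (h : Hist k) (p : ℝ≥0) :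
    ℝ≥0∞ :=
  if b then B.accept k v h p else 1 - B.accept k v h p

/-- The seller's beliefs about the buyer's value, after every history of completed rounds (the
seller learns nothing from the price that he posts himself). -/
abbrev BeliefSystem : Type := ∀ k, Hist k → Measure ℝ

/-- Expected total from a node at which the price `p` has just been posted after `h`, if every
accepted price `q` counts `w q` and `cont` is the expected total from the next round on. -/
noncomputable def respond (B : BuyerStrategy) (w : ℝ≥0 → ℝ≥0∞) (v : ℝ) {k : ℕ}
    (cont : Hist (k + 1) → ℝ≥0∞) (h : Hist k) (p : ℝ≥0) : ℝ≥0∞ :=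
  B.prob true v h p * (w p + cont (h.extend p true)) +
    B.prob false v h p * cont (h.extend p false)

/-- Expected total over the `m` rounds that follow `h`, if the buyer has value `v` and every
accepted price `q` counts `w q`. -/
noncomputable def total (S : SellerStrategy) (B : BuyerStrategy) (w : ℝ≥0 → ℝ≥0∞) (v : ℝ) :
    (m : ℕ) → {k : ℕ} → Hist k → ℝ≥0∞
  | 0, _, _ => 0
  | m + 1, k, h => ∫⁻ p, respond B w v (total S B w v m) h p ∂(S.price k h)

/-- The price itself as a weight: `total` is then the expected payment. -/
def pay (q : ℝ≥0) : ℝ≥0∞ := q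

/-- The seller's expected utility (revenue) in the `m` rounds that follow `h`, when the buyer's
value is distributed according to `μ`. -/
noncomputable def sellerUtility (S : SellerStrategy) (B : BuyerStrategy) (μ : Measure ℝ) (m : ℕ)
    {k : ℕ} (h : Hist k) : ℝ≥0∞ :=
  ∫⁻ v, total S B pay v m h ∂μ

/-- The same from the node at which the price `p` has just been posted after `h`, with `m` rounds
to follow the current one. -/
noncomputable def sellerUtilityMid (S : SellerStrategy) (B : BuyerStrategy) (μ : Measure ℝ)
    (m : ℕ) {k : ℕ} (h : Hist k) (p : ℝ≥0) : ℝ≥0∞ :=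
  ∫⁻ v, respond B pay v (total S B pay v m) h p ∂μ

/-- The expected utility of the buyer of value `v ≥ 0` in the `m` rounds that follow `h`: expected
value of the items bought (a finite number) minus expected payment (possibly infinite). -/
noncomputable def buyerUtility (S : SellerStrategy) (B : BuyerStrategy) (v : ℝ) (m : ℕ)
    {k : ℕ} (h : Hist k) : EReal :=
  (total S B (fun _ => ENNReal.ofReal v) v m h : EReal) - (total S B pay v m h : EReal)

/-- The same from the node at which the price `p` has just been posted after `h`, with `m` rounds
to follow the current one. -/
noncomputable def buyerUtilityMid (S : SellerStrategy) (B : BuyerStrategy) (v : ℝ) (m : ℕ)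
    {k : ℕ} (h : Hist k) (p : ℝ≥0) : EReal :=
  (respond B (fun _ => ENNReal.ofReal v) v (total S B (fun _ => ENNReal.ofReal v) v m) h p : EReal)
    - (respond B pay v (total S B pay v m) h p : EReal)

/-- Perfect Bayesian equilibrium of the `n`-round partial commitment repeated sales game in which
the buyer's value is drawn from `F` on the set `T` of (non-negative) values. -/
structure IsPBE (n : ℕ) (T : Set ℝ) (F : Measure ℝ)
    (S : SellerStrategy) (B : BuyerStrategy) (μ : BeliefSystem) : Prop where
  /-- beliefs are probability distributions on the set of values -/
  belief_prob : ∀ k ≤ n, ∀ h : Hist k, Legal h → IsProbabilityMeasure (μ k h) ∧ μ k h Tᶜ = 0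
  /-- the seller starts with the prior -/
  belief_root : μ 0 Hist.root = F
  /-- Bayes' rule, whenever the buyer's reaction has positive probability -/
  bayes : ∀ k < n, ∀ h : Hist k, Legal h → ∀ p, Allowed h p → ∀ b : Bool,
    (∫⁻ v, B.prob b v h p ∂(μ k h)) ≠ 0 →
      μ (k + 1) (h.extend p b) =
        (∫⁻ v, B.prob b v h p ∂(μ k h))⁻¹ • (μ k h).withDensity (fun v => B.prob b v h p)
  /-- the seller best responds at the beginning of every round -/
  seller_opt : ∀ k < n, ∀ h : Hist k, Legal h → ∀ S' : SellerStrategy,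
    sellerUtility S' B (μ k h) (n - k) h ≤ sellerUtility S B (μ k h) (n - k) h
  /-- the seller's continuation strategy is a best response after every posted price -/
  seller_opt_mid : ∀ k < n, ∀ h : Hist k, Legal h → ∀ p, Allowed h p → ∀ S' : SellerStrategy,
    sellerUtilityMid S' B (μ k h) (n - (k + 1)) h p ≤
      sellerUtilityMid S B (μ k h) (n - (k + 1)) h p
  /-- every type of the buyer best responds at the beginning of every round -/
  buyer_opt : ∀ k < n, ∀ h : Hist k, Legal h → ∀ v ∈ T, ∀ B' : BuyerStrategy,
    buyerUtility S B' v (n - k) h ≤ buyerUtility S B v (n - k) h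
  /-- every type of the buyer best responds after every posted price -/
  buyer_opt_mid : ∀ k < n, ∀ h : Hist k, Legal h → ∀ p, Allowed h p → ∀ v ∈ T,
    ∀ B' : BuyerStrategy,
      buyerUtilityMid S B' v (n - (k + 1)) h p ≤ buyerUtilityMid S B v (n - (k + 1)) h p

/-- `B` is the threshold strategy with the (non-negative) thresholds `t`: after `h`, the price `p`
is accepted exactly by the values that are at least `t k h p`. -/
def IsThreshold (B : BuyerStrategy) (t : ∀ k, Hist k → ℝ≥0 → ℝ≥0) : Prop :=
  ∀ k v (h : Hist k) p, B.accept k v h p = if (t k h p : ℝ) ≤ v then 1 else 0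

/-- The uniform distribution on `[0,1]`. -/
noncomputable def unif : Measure ℝ := volume.restrict (Set.Icc 0 1)

end RepeatedSales

open RepeatedSales

/-! The equilibrium is written down explicitly and then verified by backward induction. Two regimes
suffice.

After the first acceptance the price is frozen: the seller repeats the least accepted price, cut off
at 1 (`cap`), and the buyer accepts exactly the prices not above the value. Beliefs then live on
`[cap, 1]`, so every believed type buys in every remaining round. No raise is allowed and no cut
pays (`total_pay_le_cap`, `total_pay_eq_cap`). Hence a first acceptance of an equilibrium price `p`
with `m` rounds to follow is worth `(m+1)(v - p)` to the buyer and `(m+1)p` to the seller.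

Before the first acceptance the belief is uniform on some `[0, b]`, and the game scales with `b`.
Write `R` for `rev m`. A price whose threshold `t` is at most `b` leaves, after a rejection, the
`m`-round game on `[0, t]`. Its top type buys there at once and gets `m t - 2 R t`. Indifference of
`t` gives `(m+1)p = t(1 + 2R)`. Integrated against Lebesgue measure on `[0, b]`, the revenue is
therefore `t(1 + 2R)(b - t) + t² R`. This concave quadratic in `t` is maximal at `t = frac m * b`,
with value `b² * rev (m + 1)` (`revenue_le`, `revenue_eq`), which is the recursion.

The buyer's best responses follow from single crossing: the surplus after rejecting has slope at
most `m` in the value (`surplus_sub_le`), while accepting at a price not above the value has slope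
`m + 1`. So indifference at the threshold decides for all other types (`accept_sub_reject`). The
seller's optimality is an induction that conditions on the posted price (`lintegral_total_le`,
`lintegral_total_seller`).

For the asymptotics, `x = (1 + R)²` satisfies `x' = x + 1/2 + 1/(16x)`. Since `x ≥ 1 + n/2`, the
last terms sum to `log n / 8 + O(1)` (`sqRev_le`, `le_sqRev_sub_log`). -/

namespace RepeatedSales

/-! ### The recursion -/

/-- The normalized revenue of the `n`-round game. -/
noncomputable def rev : ℕ → ℝ≥0
  | 0 => 0
  | n + 1 => (1 + 2 * rev n) ^ 2 / (4 * (1 + rev n))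

/-- The first threshold of the game with `m + 1` rounds. -/
noncomputable def frac (m : ℕ) : ℝ≥0 := (1 + 2 * rev m) / (2 * (1 + rev m))

lemma coe_rev_succ (n : ℕ) :
    (rev (n + 1) : ℝ) = (1 + 2 * (rev n : ℝ)) ^ 2 / (4 * (1 + (rev n : ℝ))) := by
  simp [rev]

lemma coe_frac (m : ℕ) :
    (frac m : ℝ) = (1 + 2 * (rev m : ℝ)) / (2 * (1 + (rev m : ℝ))) := by
  simp [frac]

/-- Both sides, times `b`, are `m + 1` times the optimal price: the left in terms of the revenue,
the right through indifference of the type `frac m * b`. -/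
lemma two_mul_rev_succ (m : ℕ) : 2 * (rev (m + 1) : ℝ) = frac m * (1 + 2 * (rev m : ℝ)) := by
  rw [coe_rev_succ, coe_frac]
  have : (0 : ℝ) < 1 + (rev m : ℝ) := by positivity
  field_simp
  ring

lemma frac_pos (m : ℕ) : (0 : ℝ) < frac m := by
  rw [coe_frac]; positivity

lemma one_sub_frac (m : ℕ) : 1 - (frac m : ℝ) = 1 / (2 * (1 + (rev m : ℝ))) := by
  rw [coe_frac]
  have : (0 : ℝ) < 1 + (rev m : ℝ) := by positivity
  field_simp
  ring

lemma frac_le_one (m : ℕ) : (frac m : ℝ) ≤ 1 := by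
  have := one_sub_frac m
  have : 0 ≤ 1 / (2 * (1 + (rev m : ℝ))) := by positivity
  linarith

lemma one_add_rev_succ (m : ℕ) :
    1 + (rev (m + 1) : ℝ) = 1 + rev m + 1 / (4 * (1 + (rev m : ℝ))) := by
  rw [coe_rev_succ]
  have : (0 : ℝ) < 1 + (rev m : ℝ) := by positivity
  field_simp
  ring

lemma rev_le_rev_succ (m : ℕ) : (rev m : ℝ) ≤ rev (m + 1) := by
  have := one_add_rev_succ m
  have : 0 ≤ 1 / (4 * (1 + (rev m : ℝ))) := by positivity
  linarith

lemma four_mul_rev_le (m : ℕ) : 4 * (rev m : ℝ) ≤ m := by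
  induction m with
  | zero => simp [rev]
  | succ m ih =>
    have h1 := one_add_rev_succ m
    have h2 : 1 / (4 * (1 + (rev m : ℝ))) ≤ 1 / 4 := by
      apply one_div_le_one_div_of_le (by norm_num)
      have : (0 : ℝ) ≤ rev m := by positivity
      linarith
    push_cast
    linarith

lemma two_mul_rev_le (m : ℕ) : 2 * (rev m : ℝ) ≤ m := by
  have := four_mul_rev_le m
  have : (0 : ℝ) ≤ rev m := by positivity
  linarith

lemma rev_succ_pos (m : ℕ) : (0 : ℝ) < rev (m + 1) := by
  rw [coe_rev_succ]; positivity

/-- The revenue from the threshold `t` in the game on `[0, b]` is at most the claimed one. -/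
lemma revenue_le (m : ℕ) (b t : ℝ) :
    t * (1 + 2 * (rev m : ℝ)) * (b - t) + t ^ 2 * rev m ≤ b ^ 2 * rev (m + 1) := by
  rw [coe_rev_succ, mul_div_assoc', le_div_iff₀ (by positivity)]
  -- With denominators cleared, the gap between the two sides is exactly this square, which vanishes
  -- at `t = frac m * b`.
  nlinarith [sq_nonneg (2 * (1 + (rev m : ℝ)) * t - (1 + 2 * rev m) * b)]

lemma revenue_eq (m : ℕ) (b : ℝ) :
    frac m * b * (1 + 2 * (rev m : ℝ)) * (b - frac m * b) + (frac m * b) ^ 2 * rev m =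
      b ^ 2 * rev (m + 1) := by
  rw [coe_rev_succ, coe_frac]
  have : (0 : ℝ) < 1 + (rev m : ℝ) := by positivity
  field_simp
  ring

/-! ### Thresholds before the first acceptance -/

/-- The threshold at price `p` if the values are uniform on `[0, b]` and `m` rounds follow. -/
noncomputable def thresh (m : ℕ) (b p : ℝ≥0) : ℝ≥0 :=
  -- The first entry solves the indifference equation when the threshold lies in `[0, b]`. The
  -- second solves it when it lies above `b`, so that a rejection teaches nothing. The right entry
  -- is always the larger one; the subtraction truncates at 0.
  max ((m + 1) * p / (1 + 2 * rev m)) ((m + 1) * p - 2 * rev m * b)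

lemma thresh_of_le {m : ℕ} {b p : ℝ≥0} (h : (m + 1) * (p : ℝ) ≤ (1 + 2 * rev m) * b) :
    (thresh m b p : ℝ) = (m + 1) * p / (1 + 2 * rev m) := by
  have hr : (0 : ℝ) ≤ rev m := by positivity
  simp only [thresh, NNReal.coe_max, NNReal.coe_sub_def]
  push_cast
  rw [max_eq_left]
  apply max_le _ (by positivity)
  rw [le_div_iff₀ (by positivity)]
  nlinarith [mul_le_mul_of_nonneg_left h hr]

lemma thresh_of_ge {m : ℕ} {b p : ℝ≥0} (h : (1 + 2 * rev m) * b ≤ (m + 1) * (p : ℝ)) :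
    (thresh m b p : ℝ) = (m + 1) * p - 2 * rev m * b := by
  have hr : (0 : ℝ) ≤ rev m := by positivity
  have hb : (0 : ℝ) ≤ b := by positivity
  simp only [thresh, NNReal.coe_max, NNReal.coe_sub_def]
  push_cast
  have h1 : (0 : ℝ) ≤ (m + 1) * p - 2 * rev m * b := by linarith
  rw [max_eq_left h1, max_eq_right]
  rw [div_le_iff₀ (by positivity)]
  nlinarith [mul_le_mul_of_nonneg_left h hr]

lemma thresh_cases (m : ℕ) (b p : ℝ≥0) :
    ((thresh m b p : ℝ) ≤ b ∧ (thresh m b p : ℝ) * (1 + 2 * rev m) = (m + 1) * p) ∨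
      ((b : ℝ) ≤ thresh m b p ∧ (thresh m b p : ℝ) + 2 * rev m * b = (m + 1) * p) := by
  have hr : (0 : ℝ) < 1 + 2 * rev m := by positivity
  rcases le_total ((m + 1) * (p : ℝ)) ((1 + 2 * rev m) * b) with h | h
  · left
    rw [thresh_of_le h, div_le_iff₀ hr]
    exact ⟨by linarith, by field_simp⟩
  · right
    rw [thresh_of_ge h]
    exact ⟨by linarith, by ring⟩

/-- The type at the threshold is indifferent. -/
lemma thresh_add (m : ℕ) (b p : ℝ≥0) :
    (thresh m b p : ℝ) + 2 * rev m * min (b : ℝ) (thresh m b p) = (m + 1) * p := by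
  rcases thresh_cases m b p with ⟨h, h'⟩ | ⟨h, h'⟩
  · rw [min_eq_right h]; linarith
  · rw [min_eq_left h]; linarith

/-- As `2 * rev m ≤ m`, indifference gives `(m+1)p ≤ (m+1)t`. Consequently an accepted price never
exceeds the value, even off the equilibrium path. -/
lemma le_thresh (m : ℕ) (b p : ℝ≥0) : p ≤ thresh m b p := by
  rw [← NNReal.coe_le_coe]
  have h1 := thresh_add m b p
  have h2 := two_mul_rev_le m
  have hr : (0 : ℝ) ≤ rev m := by positivity
  have h3 : (0 : ℝ) ≤ thresh m b p := by positivity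
  have h4 : min (b : ℝ) (thresh m b p) ≤ thresh m b p := min_le_right _ _
  have h5 : 2 * (rev m : ℝ) * min (b : ℝ) (thresh m b p) ≤ m * thresh m b p := by
    nlinarith [mul_le_mul_of_nonneg_left h4 hr, mul_le_mul_of_nonneg_right h2 h3]
  have h6 : (0 : ℝ) < (m : ℝ) + 1 := by positivity
  nlinarith

@[simp] lemma thresh_zero (m : ℕ) (b : ℝ≥0) : thresh m b 0 = 0 := by simp [thresh]

/-- The upper end of the support of the belief after a rejection of `p`. -/
noncomputable def nextTop (m : ℕ) (b p : ℝ≥0) : ℝ≥0 :=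
  -- Rejecting the price 0 has probability zero. Keeping `b` avoids the degenerate interval `[0, 0]`
  -- and keeps the top positive.
  if p = 0 then b else min b (thresh m b p)

lemma nextTop_le (m : ℕ) (b p : ℝ≥0) : nextTop m b p ≤ b := by
  unfold nextTop; split_ifs <;> simp

lemma nextTop_pos {m : ℕ} {b p : ℝ≥0} (hb : 0 < b) : 0 < nextTop m b p := by
  unfold nextTop
  split_ifs with h
  · exact hb
  · exact lt_min hb ((pos_iff_ne_zero.2 h).trans_le (le_thresh m b p))

/-- The equilibrium price if the values are uniform on `[0, b]` and `m` rounds remain. -/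
noncomputable def quote (m : ℕ) (b : ℝ≥0) : ℝ≥0 := 2 * rev m / m * b

/-- The total paid by a type that buys from the first round on; it explains the term `2 * rev m * b`
in thresholds and surpluses. -/
lemma mul_quote (m : ℕ) (b : ℝ≥0) : (m + 1) * (quote (m + 1) b : ℝ) = 2 * rev (m + 1) * b := by
  simp only [quote]
  push_cast
  have : (0 : ℝ) < (m : ℝ) + 1 := by positivity
  field_simp

lemma thresh_quote (m : ℕ) (b : ℝ≥0) : thresh m b (quote (m + 1) b) = frac m * b := by
  rw [← NNReal.coe_inj]
  have h1 := mul_quote m b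
  have h2 := two_mul_rev_succ m
  have h3 := frac_le_one m
  have hb : (0 : ℝ) ≤ b := by positivity
  have hr : (0 : ℝ) < 1 + 2 * rev m := by positivity
  have h4 : (m + 1) * (quote (m + 1) b : ℝ) = frac m * b * (1 + 2 * rev m) := by
    rw [h1, h2]; ring
  rw [thresh_of_le, h4]
  · push_cast; field_simp
  · rw [h4]
    nlinarith [mul_le_mul_of_nonneg_right h3 (mul_nonneg hb hr.le)]

lemma nextTop_quote {m : ℕ} {b : ℝ≥0} (hb : 0 < b) :
    nextTop m b (quote (m + 1) b) = frac m * b := by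
  have hq : quote (m + 1) b ≠ 0 := by
    have h1 := mul_quote m b
    have h2 := rev_succ_pos m
    have h3 : (0 : ℝ) < b := hb
    intro h
    rw [h] at h1
    have : 0 < 2 * (rev (m + 1) : ℝ) * b := by positivity
    simp at h1
    rcases h1 with h1 | h1 <;> simp [h1] at this
  rw [nextTop, if_neg hq, thresh_quote, min_eq_right]
  rw [← NNReal.coe_le_coe]
  push_cast
  exact mul_le_of_le_one_left (by positivity) (frac_le_one m)

/-! ### The utility of the buyer before the first acceptance -/

/-- The utility of the buyer of value `v` if the seller believes that the values are uniform on
`[0, b]` and `m` rounds remain. -/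
noncomputable def surplus : ℕ → ℝ → ℝ → ℝ
  | 0, _, _ => 0
  | m + 1, b, v =>
    -- Types above the first threshold buy in all `m + 1` rounds at `quote (m + 1) b`; the others go
    -- on against a belief on `[0, frac m * b]`.
    if frac m * b ≤ v then (m + 1) * v - 2 * rev (m + 1) * b else surplus m (frac m * b) v

lemma surplus_of_le {b v : ℝ} (hb : 0 ≤ b) (h : b ≤ v) (m : ℕ) :
    surplus m b v = m * v - 2 * rev m * b := by
  cases m with
  | zero => simp [surplus, rev]
  | succ m =>
    rw [surplus, if_pos ((mul_le_of_le_one_left hb (frac_le_one m)).trans h)]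
    push_cast; rfl

/-- At most `m` items can be bought, so the surplus has slope at most `m`. The branches of `surplus`
agree at `frac m * b` by indifference, so there is no jump. This is the single-crossing property. -/
lemma surplus_sub_le (m : ℕ) {b v v' : ℝ} (hb : 0 ≤ b) (h : v ≤ v') :
    surplus m b v' - surplus m b v ≤ m * (v' - v) := by
  induction m generalizing b v v' with
  | zero => simp [surplus]
  | succ m ih =>
    have hf : 0 ≤ frac m * b := mul_nonneg (frac_pos m).le hb
    simp only [surplus]
    push_cast
    split_ifs with h1 h2 h2
    · linarith
    -- The values lie on both sides of the first threshold: the induction hypothesis is applied up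
    -- to the threshold, where the surplus is known in closed form.
    · have h3 := ih hf (not_le.1 h2).le
      rw [surplus_of_le hf le_rfl] at h3
      rw [two_mul_rev_succ]
      nlinarith
    · linarith
    · have := ih hf h
      nlinarith

lemma surplus_nonneg (m : ℕ) {b v : ℝ} (hb : 0 ≤ b) : 0 ≤ surplus m b v := by
  induction m generalizing b with
  | zero => simp [surplus]
  | succ m ih =>
    have hf : 0 ≤ frac m * b := mul_nonneg (frac_pos m).le hb
    rw [surplus]
    split_ifs with h
    · rw [two_mul_rev_succ]
      have := two_mul_rev_le m
      have : (0 : ℝ) < (m : ℝ) + 1 := by positivity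
      nlinarith
    · exact ih hf

lemma surplus_le (m : ℕ) {b v : ℝ} (hb : 0 < b) (hv : 0 ≤ v) : surplus m b v ≤ m * v := by
  -- All thresholds are positive, so the type 0 never buys; the slope bound does the rest.
  have h0 : surplus m b 0 = 0 := by
    induction m generalizing b with
    | zero => simp [surplus]
    | succ m ih =>
      have hf : 0 < frac m * b := mul_pos (frac_pos m) hb
      rw [surplus, if_neg (not_le.2 hf), ih hf]
  have := surplus_sub_le m hb.le hv
  rw [h0] at this
  simpa using this

/-- Indifference at the threshold in terms of continuation values. The threshold is at or above the
next top, so the closed form of the surplus applies. -/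
lemma surplus_nextTop {m : ℕ} {b p : ℝ≥0} (hp : p ≠ 0) :
    surplus m (nextTop m b p) (thresh m b p) = (m + 1) * ((thresh m b p : ℝ) - p) := by
  have h := thresh_add m b p
  rw [nextTop, if_neg hp, surplus_of_le (by positivity) (by simp)]
  push_cast
  linarith

/-- Below the threshold, it is best to reject; the price stays `min 1 p` after an acceptance. -/
lemma accept_le_surplus {m : ℕ} {b p : ℝ≥0} {v : ℝ} (hv : 0 ≤ v) (hv1 : v ≤ 1)
    (h : v < thresh m b p) :
    v - p + m * max (v - min 1 (p : ℝ)) 0 ≤ surplus m (nextTop m b p) v := by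
  have hp : p ≠ 0 := by
    rintro rfl
    simp at h
    linarith
  rcases le_or_gt (p : ℝ) v with h1 | h1
  · rw [min_eq_right (h1.trans hv1), max_eq_left (by linarith)]
    have h2 := surplus_sub_le m (b := nextTop m b p) (by positivity) h.le
    rw [surplus_nextTop hp] at h2
    linarith
  · have h2 := surplus_nonneg m (b := nextTop m b p) (v := v) (by positivity)
    rw [max_eq_right]
    · linarith
    · rw [sub_nonpos]; exact le_min hv1 h1.le

/-- Above the threshold, it is best to accept. -/
lemma surplus_le_accept {m : ℕ} {b p : ℝ≥0} {v : ℝ} (hb : 0 < b) (hv1 : v ≤ 1)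
    (h : (thresh m b p : ℝ) ≤ v) :
    surplus m (nextTop m b p) v ≤ v - p + m * max (v - min 1 (p : ℝ)) 0 := by
  have h1 : (p : ℝ) ≤ v := (NNReal.coe_le_coe.2 (le_thresh m b p)).trans h
  rw [min_eq_right (h1.trans hv1), max_eq_left (by linarith)]
  by_cases hp : p = 0
  · subst hp
    simp only [thresh_zero, NNReal.coe_zero] at h
    have h2 := surplus_le m (b := nextTop m b 0) (NNReal.coe_pos.2 (nextTop_pos hb)) h
    push_cast
    linarith
  · have h2 := surplus_sub_le m (b := nextTop m b p) (by positivity) h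
    rw [surplus_nextTop hp] at h2
    linarith

/-! ### The equilibrium strategies -/

/-- The history without its last round. -/
def Hist.init {k : ℕ} (h : Hist (k + 1)) : Hist k := fun i => h i.castSucc

@[simp] lemma Hist.init_extend {k : ℕ} (h : Hist k) (p : ℝ≥0) (b : Bool) :
    (h.extend p b).init = h := by
  ext i : 1
  simp [Hist.init, Hist.extend]

@[simp] lemma Hist.extend_last {k : ℕ} (h : Hist k) (p : ℝ≥0) (b : Bool) :
    h.extend p b (Fin.last k) = (p, b) := by
  simp [Hist.extend]

/-- Whether some price was accepted. -/
def locked : ∀ k, Hist k → Bool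
  | 0, _ => false
  | k + 1, h => locked k h.init || (h (Fin.last k)).2

/-- The least accepted price, but at most `1`. -/
noncomputable def cap : ∀ k, Hist k → ℝ≥0
  -- Starting from 1 cuts off prices above every possible value: even if such a price was accepted,
  -- posting `cap` still sells to the type 1.
  | 0, _ => 1
  | k + 1, h => if (h (Fin.last k)).2 then min (cap k h.init) (h (Fin.last k)).1 else cap k h.init

/-- The upper end of the support of the belief while nothing was accepted. -/
noncomputable def top (n : ℕ) : ∀ k, Hist k → ℝ≥0
  | 0, _ => 1
  | k + 1, h => nextTop (n - (k + 1)) (top n k h.init) (h (Fin.last k)).1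

/-- The price that the seller posts. -/
noncomputable def offer (n k : ℕ) (h : Hist k) : ℝ≥0 :=
  if locked k h then cap k h else quote (n - k) (top n k h)

/-- The threshold of the buyer. -/
noncomputable def threshold (n k : ℕ) (h : Hist k) (p : ℝ≥0) : ℝ≥0 :=
  if locked k h then p else thresh (n - (k + 1)) (top n k h) p

section extend

variable {k : ℕ} (n : ℕ) (h : Hist k) (p : ℝ≥0) (b : Bool)

@[simp] lemma locked_extend : locked (k + 1) (h.extend p b) = (locked k h || b) := by
  simp [locked]

@[simp] lemma cap_extend_true : cap (k + 1) (h.extend p true) = min (cap k h) p := by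
  simp [cap]

@[simp] lemma cap_extend_false : cap (k + 1) (h.extend p false) = cap k h := by
  simp [cap]

@[simp] lemma top_extend :
    top n (k + 1) (h.extend p b) = nextTop (n - (k + 1)) (top n k h) p := by
  simp [top]

end extend

/-! ### Bounds and feasibility for the state of a history -/

lemma cap_le_one : ∀ k (h : Hist k), cap k h ≤ 1
  | 0, _ => le_rfl
  | k + 1, h => by
    have := cap_le_one k h.init
    rw [cap]
    split_ifs
    · exact (min_le_left _ _).trans this
    · exact this

lemma cap_of_not_locked : ∀ k (h : Hist k), locked k h = false → cap k h = 1
  | 0, _, _ => rfl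
  | k + 1, h, hl => by
    simp only [locked, Bool.or_eq_false_iff] at hl
    simp [cap, hl.2, cap_of_not_locked k h.init hl.1]

lemma top_le_one (n : ℕ) : ∀ k (h : Hist k), top n k h ≤ 1
  | 0, _ => le_rfl
  | k + 1, h => (nextTop_le _ _ _).trans (top_le_one n k h.init)

lemma top_pos (n : ℕ) : ∀ k (h : Hist k), 0 < top n k h
  | 0, _ => one_pos
  | k + 1, h => nextTop_pos (top_pos n k h.init)

lemma allowed_of_not_locked : ∀ k (h : Hist k), locked k h = false → ∀ p, Allowed h p
  | 0, _, _, _, i => i.elim0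
  | k + 1, h, hl, p, i => by
    simp only [locked, Bool.or_eq_false_iff] at hl
    induction i using Fin.lastCases with
    | last => intro h1; simp [hl.2] at h1
    | cast i => exact allowed_of_not_locked k h.init hl.1 p i

lemma allowed_cap : ∀ k (h : Hist k), Allowed h (cap k h)
  | 0, _, i => i.elim0
  | k + 1, h, i => by
    intro hi
    rw [cap]
    induction i using Fin.lastCases with
    | last => rw [if_pos hi]; exact min_le_right _ _
    | cast i =>
      have := allowed_cap k h.init i hi
      split_ifs
      · exact (min_le_left _ _).trans this
      · exact this

/-- The only place where partial commitment limits the seller: an allowed price that some type in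
`[0, 1]` could accept is at most `cap`. -/
lemma le_cap : ∀ k (h : Hist k) (p : ℝ≥0), Allowed h p → p ≤ 1 → p ≤ cap k h
  | 0, _, _, _, h1 => h1
  | k + 1, h, p, hp, h1 => by
    have := le_cap k h.init p (fun i => hp i.castSucc) h1
    rw [cap]
    split_ifs with hl
    · exact le_min this (hp _ hl)
    · exact this

lemma allowed_offer (n k : ℕ) (h : Hist k) : Allowed h (offer n k h) := by
  unfold offer
  split_ifs with hl
  · exact allowed_cap k h
  · exact allowed_of_not_locked k h (by simpa using hl) _

lemma le_threshold (n k : ℕ) (h : Hist k) (p : ℝ≥0) : p ≤ threshold n k h p := by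
  unfold threshold
  split_ifs
  · exact le_rfl
  · exact le_thresh _ _ _

section Measurability

@[fun_prop] lemma measurable_hist_init {k : ℕ} :
    Measurable (Hist.init : Hist (k + 1) → Hist k) :=
  measurable_pi_lambda _ fun i => measurable_pi_apply i.castSucc

lemma measurable_locked : ∀ k, Measurable (locked k)
  | 0 => measurable_const
  | k + 1 => by
    have h1 : Measurable fun h : Hist (k + 1) => (locked k h.init, (h (Fin.last k)).2) :=
      ((measurable_locked k).comp measurable_hist_init).prodMk
        (measurable_snd.comp (measurable_pi_apply _))
    exact (Measurable.of_discrete (f := fun x : Bool × Bool => x.1 || x.2)).comp h1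

lemma measurableSet_locked (k : ℕ) : MeasurableSet {h : Hist k | locked k h = true} :=
  measurable_locked k (measurableSet_singleton true)

lemma measurable_cap : ∀ k, Measurable (cap k)
  | 0 => measurable_const
  | k + 1 => by
    have h1 := (measurable_cap k).comp (measurable_hist_init (k := k))
    have h2 : Measurable fun h : Hist (k + 1) => (h (Fin.last k)).1 :=
      measurable_fst.comp (measurable_pi_apply _)
    have h3 : Measurable fun h : Hist (k + 1) => (h (Fin.last k)).2 :=
      measurable_snd.comp (measurable_pi_apply _)
    exact Measurable.ite (h3 (measurableSet_singleton true)) (h1.min h2) h1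

lemma measurable_thresh (m : ℕ) {α : Type*} [MeasurableSpace α] {f g : α → ℝ≥0}
    (hf : Measurable f) (hg : Measurable g) : Measurable fun x => thresh m (f x) (g x) := by
  unfold thresh
  fun_prop

lemma measurable_top (n : ℕ) : ∀ k, Measurable (top n k)
  | 0 => measurable_const
  | k + 1 => by
    have h1 := (measurable_top n k).comp (measurable_hist_init (k := k))
    have h2 : Measurable fun h : Hist (k + 1) => (h (Fin.last k)).1 :=
      measurable_fst.comp (measurable_pi_apply _)
    exact Measurable.ite (h2 (measurableSet_singleton 0)) h1
      (h1.min (measurable_thresh _ h1 h2))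

lemma measurable_offer (n k : ℕ) : Measurable (offer n k) :=
  Measurable.ite (measurableSet_locked k) (measurable_cap k)
    ((measurable_top n k).const_mul _)

lemma measurable_threshold (n k : ℕ) :
    Measurable fun x : Hist k × ℝ≥0 => threshold n k x.1 x.2 :=
  Measurable.ite (measurable_fst (measurableSet_locked k)) measurable_snd
    (measurable_thresh _ ((measurable_top n k).comp measurable_fst) measurable_snd)

end Measurability

/-- The equilibrium strategy of the seller in the game with `n` rounds. -/
noncomputable def seller (n : ℕ) : SellerStrategy where
  price k := Kernel.deterministic (offer n k) (measurable_offer n k)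
  markov _ := inferInstance
  noRaise k h := by
    rw [Kernel.deterministic_apply, ae_dirac_eq]
    exact allowed_offer n k h

/-- The equilibrium strategy of the buyer in the game with `n` rounds. -/
noncomputable def buyer (n : ℕ) : BuyerStrategy where
  accept k v h p := if (threshold n k h p : ℝ) ≤ v then 1 else 0
  accept_le_one k v h p := by split_ifs <;> simp
  measurable_accept k := by
    refine Measurable.ite (measurableSet_le ?_ measurable_fst) measurable_const measurable_const
    exact ((measurable_threshold n k).comp measurable_snd).coe_nnreal_real

lemma isThreshold_buyer (n : ℕ) : IsThreshold (buyer n) (threshold n) := fun _ _ _ _ => rfl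

/-! ### The response of the buyer -/

lemma prob_true_add_prob_false (B : BuyerStrategy) {k : ℕ} (v : ℝ) (h : Hist k) (p : ℝ≥0) :
    B.prob true v h p + B.prob false v h p = 1 := by
  simpa [BuyerStrategy.prob] using add_tsub_cancel_of_le (B.accept_le_one k v h p)

lemma buyer_prob_true (n : ℕ) {k : ℕ} (v : ℝ) (h : Hist k) (p : ℝ≥0) :
    (buyer n).prob true v h p = if (threshold n k h p : ℝ) ≤ v then 1 else 0 := rfl

lemma buyer_prob_false (n : ℕ) {k : ℕ} (v : ℝ) (h : Hist k) (p : ℝ≥0) :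
    (buyer n).prob false v h p = if v < threshold n k h p then 1 else 0 := by
  simp only [BuyerStrategy.prob, buyer, Bool.false_eq_true, if_false]
  split_ifs with h1 h2 h2
  · exact absurd h1 (not_le.2 h2)
  · simp
  · simp
  · exact absurd (not_lt.1 h2) h1

lemma respond_buyer (n : ℕ) (w : ℝ≥0 → ℝ≥0∞) (v : ℝ) {k : ℕ} (c : Hist (k + 1) → ℝ≥0∞)
    (h : Hist k) (p : ℝ≥0) :
    respond (buyer n) w v c h p =
      if (threshold n k h p : ℝ) ≤ v then w p + c (h.extend p true) else c (h.extend p false) := by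
  rw [respond, buyer_prob_true, buyer_prob_false]
  split_ifs with h1 h2 h2
  · exact absurd h1 (not_le.2 h2)
  · simp
  · simp
  · exact absurd (not_lt.1 h2) h1

lemma respond_le_of_le (B : BuyerStrategy) (w : ℝ≥0 → ℝ≥0∞) (v : ℝ) {k : ℕ}
    (c : Hist (k + 1) → ℝ≥0∞) (h : Hist k) (p : ℝ≥0) {a : ℝ≥0∞}
    (h1 : w p + c (h.extend p true) ≤ a) (h0 : c (h.extend p false) ≤ a) :
    respond B w v c h p ≤ a := by
  calc respond B w v c h p ≤ B.prob true v h p * a + B.prob false v h p * a := by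
        unfold respond; gcongr
    _ = a := by rw [← add_mul, prob_true_add_prob_false, one_mul]

lemma total_seller (n : ℕ) (B : BuyerStrategy) (w : ℝ≥0 → ℝ≥0∞) (v : ℝ) (m : ℕ) {k : ℕ}
    (h : Hist k) :
    total (seller n) B w v (m + 1) h =
      respond B w v (total (seller n) B w v m) h (offer n k h) := by
  simp [total, seller, Kernel.deterministic_apply]

/-- Verification of a value function `W` for the buyer at a posted price. -/
lemma respond_le_add (B : BuyerStrategy) (v : ℝ) {k : ℕ} {G P : Hist (k + 1) → ℝ≥0∞}
    {W : Bool → ℝ≥0∞} {M : ℝ≥0∞} (h : Hist k) (p : ℝ≥0)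
    (hG : ∀ b, G (h.extend p b) ≤ P (h.extend p b) + W b)
    (h1 : ENNReal.ofReal v + W true ≤ p + M) (h0 : W false ≤ M) :
    respond B (fun _ => ENNReal.ofReal v) v G h p ≤ respond B pay v P h p + M := by
  set a := B.prob true v h p with ha
  set c := B.prob false v h p with hc
  have hac : a + c = 1 := prob_true_add_prob_false B v h p
  calc respond B (fun _ => ENNReal.ofReal v) v G h p
      = a * (ENNReal.ofReal v + G (h.extend p true)) + c * G (h.extend p false) := rfl
    _ ≤ a * (ENNReal.ofReal v + (P (h.extend p true) + W true)) +
          c * (P (h.extend p false) + W false) := by gcongr <;> apply hG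
    _ = a * (P (h.extend p true) + (ENNReal.ofReal v + W true)) +
          c * (P (h.extend p false) + W false) := by ring
    _ ≤ a * (P (h.extend p true) + (p + M)) + c * (P (h.extend p false) + M) := by gcongr
    _ = a * (p + P (h.extend p true)) + c * P (h.extend p false) + (a + c) * M := by ring
    _ = respond B pay v P h p + M := by rw [hac, one_mul]; rfl

/-! ### Optimality for the buyer -/

/-- The utility of the buyer of value `v` after `h` in equilibrium. -/
noncomputable def value (n : ℕ) (v : ℝ) (k : ℕ) (h : Hist k) : ℝ :=
  if locked k h then (n - k : ℕ) * max (v - cap k h) 0 else surplus (n - k) (top n k h) v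

/-- The utility of the buyer of value `v` in equilibrium when `p` was posted after `h`. -/
noncomputable def midValue (n : ℕ) (v : ℝ) (k : ℕ) (h : Hist k) (p : ℝ≥0) : ℝ :=
  if (threshold n k h p : ℝ) ≤ v then v - p + value n v (k + 1) (h.extend p true)
  else value n v (k + 1) (h.extend p false)

lemma value_nonneg (n : ℕ) (v : ℝ) (k : ℕ) (h : Hist k) : 0 ≤ value n v k h := by
  unfold value
  split_ifs
  · positivity
  · exact surplus_nonneg _ (by positivity)

/-- The one-shot deviation principle for the buyer, at every price and not only at the equilibrium
one. After an acceptance, buying can only lower later prices, and a price above the value brings no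
later gain that would repay it. -/
lemma accept_sub_reject (n : ℕ) {v : ℝ} (hv : 0 ≤ v) (hv1 : v ≤ 1) (k : ℕ) (h : Hist k)
    (p : ℝ≥0) :
    ((threshold n k h p : ℝ) ≤ v →
        value n v (k + 1) (h.extend p false) ≤ v - p + value n v (k + 1) (h.extend p true)) ∧
      (v < threshold n k h p →
        v - p + value n v (k + 1) (h.extend p true) ≤ value n v (k + 1) (h.extend p false)) := by
  set m := n - (k + 1) with hm
  cases hl : locked k h with
  | true =>
    simp only [value, threshold, locked_extend, hl, cap_extend_true, cap_extend_false, if_true,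
      Bool.true_or, ← hm, NNReal.coe_min]
    have hmin : min (cap k h : ℝ) p ≤ cap k h := min_le_left _ _
    constructor
    · intro h1
      have : max (v - (cap k h : ℝ)) 0 ≤ max (v - min (cap k h : ℝ) p) 0 := by gcongr
      have : (m : ℝ) * max (v - (cap k h : ℝ)) 0 ≤ m * max (v - min (cap k h : ℝ) p) 0 := by
        gcongr
      linarith
    · intro h1
      have : max (v - min (cap k h : ℝ) p) 0 ≤ max (v - (cap k h : ℝ)) 0 := by
        rcases min_choice (cap k h : ℝ) p with h2 | h2
        · rw [h2]
        · rw [h2, max_eq_right (by linarith)]; exact le_max_right _ _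
      have : (m : ℝ) * max (v - min (cap k h : ℝ) p) 0 ≤ m * max (v - (cap k h : ℝ)) 0 := by
        gcongr
      linarith
  | false =>
    simp only [value, threshold, locked_extend, hl, cap_extend_true, top_extend, if_true,
      Bool.false_or, ← hm, NNReal.coe_min, cap_of_not_locked k h hl, Bool.false_eq_true,
      if_false, NNReal.coe_one]
    exact ⟨surplus_le_accept (top_pos n k h) hv1, accept_le_surplus hv hv1⟩

/-- The Bellman equation of the buyer along the seller's equilibrium price. Here `v ≤ 1` ensures
that the cut-off at 1 does not affect a price that the type accepts. -/
lemma value_eq_midValue (n : ℕ) {v : ℝ} (hv1 : v ≤ 1) {k : ℕ} (hk : k < n) (h : Hist k) :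
    value n v k h = midValue n v k h (offer n k h) := by
  obtain ⟨m, rfl⟩ : ∃ m, n = k + (m + 1) := ⟨n - k - 1, by omega⟩
  have e1 : k + (m + 1) - k = m + 1 := by omega
  have e2 : k + (m + 1) - (k + 1) = m := by omega
  cases hl : locked k h with
  | true =>
    simp only [midValue, value, threshold, offer, locked_extend, hl, cap_extend_true,
      cap_extend_false, if_true, Bool.true_or, e1, e2, min_self]
    split_ifs with h1
    · rw [max_eq_left (by linarith)]; push_cast; ring
    · rw [max_eq_right (by linarith)]; simp
  | false =>
    simp only [midValue, value, threshold, offer, locked_extend, hl, cap_extend_true, top_extend,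
      if_true, Bool.false_or, NNReal.coe_min, cap_of_not_locked k h hl, Bool.false_eq_true,
      if_false, NNReal.coe_one, e1, e2, thresh_quote, nextTop_quote (top_pos _ k h), surplus,
      NNReal.coe_mul]
    split_ifs with h1
    · have h2 : (quote (m + 1) (top (k + (m + 1)) k h) : ℝ) ≤ v := by
        refine le_trans ?_ h1
        have := NNReal.coe_le_coe.2
          (le_thresh m (top (k + (m + 1)) k h) (quote (m + 1) (top (k + (m + 1)) k h)))
        rwa [thresh_quote, NNReal.coe_mul] at this
      have h3 := mul_quote m (top (k + (m + 1)) k h)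
      rw [min_eq_right (h2.trans hv1), max_eq_left (by linarith)]
      linarith
    · rfl

lemma midValue_nonneg (n : ℕ) (v : ℝ) (k : ℕ) (h : Hist k) (p : ℝ≥0) :
    0 ≤ midValue n v k h p := by
  unfold midValue
  have := le_threshold n k h p
  split_ifs with h1
  · have := NNReal.coe_le_coe.2 this
    have := value_nonneg n v (k + 1) (h.extend p true)
    linarith
  · exact value_nonneg _ _ _ _

lemma ofReal_add_value_le (n : ℕ) {v : ℝ} (hv : 0 ≤ v) (hv1 : v ≤ 1) (k : ℕ) (h : Hist k)
    (p : ℝ≥0) :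
    ENNReal.ofReal v + ENNReal.ofReal (value n v (k + 1) (h.extend p true)) ≤
      p + ENNReal.ofReal (midValue n v k h p) := by
  rw [← ENNReal.ofReal_coe_nnreal, ← ENNReal.ofReal_add hv (value_nonneg _ _ _ _),
    ← ENNReal.ofReal_add p.coe_nonneg (midValue_nonneg _ _ _ _ _)]
  apply ENNReal.ofReal_le_ofReal
  have := accept_sub_reject n hv hv1 k h p
  unfold midValue
  split_ifs with h1
  · linarith
  · linarith [this.2 (not_le.1 h1)]

lemma value_reject_le (n : ℕ) {v : ℝ} (hv : 0 ≤ v) (hv1 : v ≤ 1) (k : ℕ) (h : Hist k)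
    (p : ℝ≥0) :
    ENNReal.ofReal (value n v (k + 1) (h.extend p false)) ≤
      ENNReal.ofReal (midValue n v k h p) := by
  apply ENNReal.ofReal_le_ofReal
  unfold midValue
  split_ifs with h1
  · exact (accept_sub_reject n hv hv1 k h p).1 h1
  · rfl

/-- No strategy of the buyer gives more than `value`. -/
lemma total_le_pay_add_value (n : ℕ) (B : BuyerStrategy) {v : ℝ} (hv : 0 ≤ v) (hv1 : v ≤ 1)
    (m : ℕ) {k : ℕ} (hk : k + m = n) (h : Hist k) :
    total (seller n) B (fun _ => ENNReal.ofReal v) v m h ≤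
      total (seller n) B pay v m h + ENNReal.ofReal (value n v k h) := by
  induction m generalizing k with
  | zero => simp [total]
  | succ m ih =>
    rw [total_seller, total_seller, value_eq_midValue n hv1 (by omega)]
    exact respond_le_add B v (W := fun b => ENNReal.ofReal (value n v (k + 1) (h.extend _ b))) h _
      (fun b => ih (by omega) _)
      (ofReal_add_value_le n hv hv1 k h _) (value_reject_le n hv hv1 k h _)

lemma respond_le_pay_add_midValue (n : ℕ) (B : BuyerStrategy) {v : ℝ} (hv : 0 ≤ v) (hv1 : v ≤ 1)
    (m : ℕ) {k : ℕ} (hk : k + (m + 1) = n) (h : Hist k) (p : ℝ≥0) :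
    respond B (fun _ => ENNReal.ofReal v) v
        (total (seller n) B (fun _ => ENNReal.ofReal v) v m) h p ≤
      respond B pay v (total (seller n) B pay v m) h p + ENNReal.ofReal (midValue n v k h p) :=
  respond_le_add B v (W := fun b => ENNReal.ofReal (value n v (k + 1) (h.extend _ b))) h _
    (fun _ => total_le_pay_add_value n B hv hv1 m (by omega) _)
    (ofReal_add_value_le n hv hv1 k h _) (value_reject_le n hv hv1 k h _)

lemma respond_buyer_eq {n : ℕ} {v : ℝ} (hv : 0 ≤ v) {k : ℕ} {G P : Hist (k + 1) → ℝ≥0∞}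
    (h : Hist k) (p : ℝ≥0)
    (hG : ∀ b, G (h.extend p b) =
      P (h.extend p b) + ENNReal.ofReal (value n v (k + 1) (h.extend p b))) :
    respond (buyer n) (fun _ => ENNReal.ofReal v) v G h p =
      respond (buyer n) pay v P h p + ENNReal.ofReal (midValue n v k h p) := by
  rw [respond_buyer, respond_buyer, hG, hG]
  split_ifs with h1
  · have h2 : ENNReal.ofReal v + ENNReal.ofReal (value n v (k + 1) (h.extend p true)) =
        p + ENNReal.ofReal (midValue n v k h p) := by
      rw [← ENNReal.ofReal_coe_nnreal, ← ENNReal.ofReal_add hv (value_nonneg _ _ _ _),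
        ← ENNReal.ofReal_add p.coe_nonneg (midValue_nonneg _ _ _ _ _), midValue, if_pos h1]
      congr 1; ring
    rw [pay, add_left_comm, h2]
    ring
  · rw [midValue, if_neg h1]

lemma total_buyer_eq (n : ℕ) {v : ℝ} (hv : 0 ≤ v) (hv1 : v ≤ 1)
    (m : ℕ) {k : ℕ} (hk : k + m = n) (h : Hist k) :
    total (seller n) (buyer n) (fun _ => ENNReal.ofReal v) v m h =
      total (seller n) (buyer n) pay v m h + ENNReal.ofReal (value n v k h) := by
  induction m generalizing k with
  | zero =>
    obtain rfl : k = n := by omega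
    simp [total, value, surplus]
  | succ m ih =>
    rw [total_seller, total_seller, value_eq_midValue n hv1 (by omega)]
    exact respond_buyer_eq hv h _ fun b => ih (by omega) _

/-! ### From additive comparisons to extended-real utilities -/

/-- Against threshold strategies, no type ever pays more than its value. -/
lemma total_pay_le_value (S : SellerStrategy) (n : ℕ) (v : ℝ) (m : ℕ) {k : ℕ} (h : Hist k) :
    total S (buyer n) pay v m h ≤ m * ENNReal.ofReal v := by
  induction m generalizing k with
  | zero => simp [total]
  | succ m ih =>
    have : IsMarkovKernel (S.price k) := S.markov k
    rw [total]
    refine (lintegral_mono (g := fun _ => ((m + 1 : ℕ) : ℝ≥0∞) * ENNReal.ofReal v)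
      fun p => ?_).trans (by simp)
    rw [respond_buyer]
    push_cast
    split_ifs with h1
    · have h2 : (p : ℝ≥0∞) ≤ ENNReal.ofReal v := by
        rw [← ENNReal.ofReal_coe_nnreal]
        exact ENNReal.ofReal_le_ofReal
          ((NNReal.coe_le_coe.2 (le_threshold n k h p)).trans h1)
      rw [add_mul, one_mul, add_comm]
      exact add_le_add (ih _) h2
    · exact (ih _).trans (by gcongr; simp)

/-- The buyer's induction compares item value with payment plus surplus, without subtraction; this
turns the result into a utility bound. An infinite payment gives utility `⊥`. -/
lemma sub_le_of_le_add {a b c : ℝ≥0∞} (ha : a ≠ ⊤) (h : a ≤ b + c) :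
    (a : EReal) - (b : EReal) ≤ c := by
  have h' : (a : EReal) ≤ b + c := by exact_mod_cast h
  induction b with
  | top => lift a to ℝ≥0 using ha; simp
  | coe b =>
    rw [EReal.sub_le_iff_le_add (by simp) (by simp), add_comm]
    exact h'

lemma coe_add_sub_coe {b c : ℝ≥0∞} (hb : b ≠ ⊤) : ((b + c : ℝ≥0∞) : EReal) - (b : EReal) = c := by
  lift b to ℝ≥0 using hb
  rw [EReal.coe_ennreal_add, add_comm]
  exact EReal.add_sub_cancel_right

lemma total_const_le (S : SellerStrategy) (B : BuyerStrategy) (a : ℝ≥0∞) (v : ℝ) (m : ℕ) {k : ℕ}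
    (h : Hist k) : total S B (fun _ => a) v m h ≤ m * a := by
  induction m generalizing k with
  | zero => simp [total]
  | succ m ih =>
    have : IsMarkovKernel (S.price k) := S.markov k
    rw [total]
    refine (lintegral_mono (g := fun _ => ((m + 1 : ℕ) : ℝ≥0∞) * a) fun p => ?_).trans (by simp)
    push_cast
    rw [add_mul, one_mul]
    apply respond_le_of_le
    · rw [add_comm]
      exact add_le_add_left (ih _) _
    · exact (ih _).trans le_self_add

lemma buyerUtility_le (n : ℕ) (B : BuyerStrategy) {v : ℝ} (hv : 0 ≤ v) (hv1 : v ≤ 1)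
    {k : ℕ} (hk : k < n) (h : Hist k) :
    buyerUtility (seller n) B v (n - k) h ≤ buyerUtility (seller n) (buyer n) v (n - k) h := by
  have hkn : k + (n - k) = n := by omega
  unfold buyerUtility
  rw [total_buyer_eq n hv hv1 _ hkn h, coe_add_sub_coe]
  · refine sub_le_of_le_add ?_ (total_le_pay_add_value n B hv hv1 _ hkn h)
    exact ne_top_of_le_ne_top (by finiteness) (total_const_le _ _ _ _ _ _)
  · exact ne_top_of_le_ne_top (by finiteness) (total_pay_le_value _ _ _ _ _)

lemma buyerUtilityMid_le (n : ℕ) (B : BuyerStrategy) {v : ℝ} (hv : 0 ≤ v) (hv1 : v ≤ 1)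
    {k : ℕ} (hk : k < n) (h : Hist k) (p : ℝ≥0) :
    buyerUtilityMid (seller n) B v (n - (k + 1)) h p ≤
      buyerUtilityMid (seller n) (buyer n) v (n - (k + 1)) h p := by
  have hkn : k + (n - (k + 1) + 1) = n := by omega
  unfold buyerUtilityMid
  rw [respond_buyer_eq hv h p fun b => total_buyer_eq n hv hv1 _ (by omega) _, coe_add_sub_coe]
  · refine sub_le_of_le_add ?_ (respond_le_pay_add_midValue n B hv hv1 _ hkn h p)
    refine ne_top_of_le_ne_top (b := ENNReal.ofReal v + (n - (k + 1) : ℕ) * ENNReal.ofReal v)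
      (by finiteness) (respond_le_of_le _ _ _ _ _ _ ?_ ?_)
    · gcongr
      exact total_const_le _ _ _ _ _ _
    · exact (total_const_le _ _ _ _ _ _).trans le_add_self
  · refine ne_top_of_le_ne_top (b := (p : ℝ≥0∞) + (n - (k + 1) : ℕ) * ENNReal.ofReal v)
      (by finiteness) (respond_le_of_le _ _ _ _ _ _ ?_ ?_)
    · rw [pay]
      gcongr
      exact total_pay_le_value _ _ _ _ _
    · exact (total_pay_le_value _ _ _ _ _).trans le_add_self

/-! ### Measurability of the expected totals -/

lemma measurable_extend {k : ℕ} (b : Bool) :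
    Measurable fun x : Hist k × ℝ≥0 => x.1.extend x.2 b := by
  refine measurable_pi_lambda _ fun i => ?_
  induction i using Fin.lastCases with
  | last =>
    simp only [Hist.extend_last]
    exact measurable_snd.prodMk measurable_const
  | cast i =>
    simp only [Hist.extend, Fin.snoc_castSucc]
    exact (measurable_pi_apply i).comp measurable_fst

lemma measurable_prob (B : BuyerStrategy) {k : ℕ} (b : Bool) :
    Measurable fun x : ℝ × Hist k × ℝ≥0 => B.prob b x.1 x.2.1 x.2.2 := by
  cases b
  · simpa [BuyerStrategy.prob] using (B.measurable_accept k).const_sub 1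
  · simpa [BuyerStrategy.prob] using B.measurable_accept k

lemma measurable_respond (B : BuyerStrategy) {w : ℝ≥0 → ℝ≥0∞} (hw : Measurable w) {k : ℕ}
    {F : ℝ → Hist (k + 1) → ℝ≥0∞} (hF : Measurable fun x : ℝ × Hist (k + 1) => F x.1 x.2) :
    Measurable fun x : ℝ × Hist k × ℝ≥0 => respond B w x.1 (F x.1) x.2.1 x.2.2 := by
  have hF' (b : Bool) : Measurable fun x : ℝ × Hist k × ℝ≥0 => F x.1 (x.2.1.extend x.2.2 b) :=
    hF.comp (measurable_fst.prodMk ((measurable_extend b).comp measurable_snd))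
  have hw' : Measurable fun x : ℝ × Hist k × ℝ≥0 => w x.2.2 :=
    hw.comp (measurable_snd.comp measurable_snd)
  exact ((measurable_prob B true).mul (hw'.add (hF' true))).add
    ((measurable_prob B false).mul (hF' false))

/-- Joint measurability in value and history is needed to exchange the integrals over values and
over randomized prices in `lintegral_total_le`. -/
lemma measurable_total (S : SellerStrategy) (B : BuyerStrategy) {w : ℝ≥0 → ℝ≥0∞}
    (hw : Measurable w) (m : ℕ) {k : ℕ} :
    Measurable fun x : ℝ × Hist k => total S B w x.1 m x.2 := by
  induction m generalizing k with
  | zero => exact measurable_const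
  | succ m ih =>
    have : IsMarkovKernel (S.price k) := S.markov k
    have h := (measurable_respond B hw (F := fun v => total S B w v m) (ih (k := k + 1))).comp
      (MeasurableEquiv.prodAssoc (α := ℝ) (β := Hist k) (γ := ℝ≥0)).measurable
    exact Measurable.lintegral_kernel_prod_right'
      (κ := (S.price k).comap Prod.snd (measurable_snd (α := ℝ))) h

lemma measurable_pay : Measurable pay := measurable_coe_nnreal_ennreal

/-! ### Optimality for the seller -/

/-- Under partial commitment, no strategy of the seller earns more than `cap` in any round. -/
lemma total_pay_le_cap (S : SellerStrategy) (n : ℕ) {v : ℝ} (hv1 : v ≤ 1) (m : ℕ) {k : ℕ}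
    (h : Hist k) : total S (buyer n) pay v m h ≤ m * cap k h := by
  induction m generalizing k with
  | zero => simp [total]
  | succ m ih =>
    have : IsMarkovKernel (S.price k) := S.markov k
    rw [total]
    refine (lintegral_mono_ae (g := fun _ => ((m + 1 : ℕ) : ℝ≥0∞) * cap k h) ?_).trans (by simp)
    filter_upwards [S.noRaise k h] with p hp
    rw [respond_buyer]
    push_cast
    rw [add_mul, one_mul]
    split_ifs with h1
    · have h2 : p ≤ cap k h := by
        apply le_cap k h p hp
        rw [← NNReal.coe_le_coe]
        exact ((NNReal.coe_le_coe.2 (le_threshold n k h p)).trans h1).trans hv1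
      rw [add_comm]
      refine add_le_add ((ih _).trans ?_) (by simpa [pay] using h2)
      rw [cap_extend_true]
      gcongr
      exact min_le_left _ _
    · refine (ih _).trans ?_
      rw [cap_extend_false]
      exact le_self_add

/-- After an acceptance, the equilibrium revenue is the largest possible. -/
lemma total_pay_eq_cap (n : ℕ) {v : ℝ} (m : ℕ) {k : ℕ} (h : Hist k) (hl : locked k h = true)
    (hv : (cap k h : ℝ) ≤ v) :
    total (seller n) (buyer n) pay v m h = m * cap k h := by
  induction m generalizing k with
  | zero => simp [total]
  | succ m ih =>
    have h1 : offer n k h = cap k h := by rw [offer, if_pos hl]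
    rw [total_seller, respond_buyer, h1, threshold, if_pos hl, if_pos hv,
      ih _ (by simp) (by simpa using hv), cap_extend_true, min_self, pay]
    push_cast
    ring

lemma total_pay_le_seller (S : SellerStrategy) (n : ℕ) {v : ℝ} (m : ℕ) {k : ℕ} (h : Hist k)
    (hl : locked k h = true) (hv : (cap k h : ℝ) ≤ v) (hv1 : v ≤ 1) :
    total S (buyer n) pay v m h ≤ total (seller n) (buyer n) pay v m h := by
  rw [total_pay_eq_cap n m h hl hv]
  exact total_pay_le_cap S n hv1 m h

lemma Icc_inter_Iio_ae_eq (b t : ℝ) :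
    (Set.Icc 0 b ∩ Set.Iio t : Set ℝ) =ᵐ[volume] Set.Icc 0 (min b t) := by
  have h : Set.Icc 0 (min b t) = Set.Icc 0 b ∩ Set.Iic t := by
    ext x; simp [and_assoc]
  rw [h]
  exact (ae_eq_refl _).inter Iio_ae_eq_Iic

/-- Before the first acceptance, the reaction splits the interval of possible values. -/
lemma lintegral_respond (n : ℕ) {k : ℕ} (h : Hist k) (hl : locked k h = false) (p : ℝ≥0)
    (F : ℝ → Hist (k + 1) → ℝ≥0∞) :
    ∫⁻ v in Set.Icc 0 (top n k h : ℝ), respond (buyer n) pay v (F v) h p =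
      (∫⁻ v in Set.Icc (threshold n k h p : ℝ) (top n k h), (p + F v (h.extend p true))) +
        if p = 0 then 0 else
          ∫⁻ v in Set.Icc 0 (top n (k + 1) (h.extend p false) : ℝ), F v (h.extend p false) := by
  rw [← lintegral_inter_add_sdiff _ _ (measurableSet_Ici (a := (threshold n k h p : ℝ)))]
  have e1 : (Set.Icc 0 (top n k h : ℝ) ∩ Set.Ici (threshold n k h p : ℝ)) =
      Set.Icc (threshold n k h p : ℝ) (top n k h) := by
    ext x
    simp only [Set.mem_inter_iff, Set.mem_Icc, Set.mem_Ici]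
    exact ⟨fun hx => ⟨hx.2, hx.1.2⟩, fun hx => ⟨⟨(NNReal.coe_nonneg _).trans hx.1, hx.2⟩, hx.1⟩⟩
  have e2 : (Set.Icc 0 (top n k h : ℝ) \ Set.Ici (threshold n k h p : ℝ)) =
      Set.Icc 0 (top n k h : ℝ) ∩ Set.Iio (threshold n k h p : ℝ) := by
    rw [Set.sdiff_eq, Set.compl_Ici]
  rw [e1, e2]
  congr 1
  · refine setLIntegral_congr_fun measurableSet_Icc fun v hv => ?_
    simp only [respond_buyer]
    rw [if_pos hv.1, pay]
  · have : ∫⁻ v in Set.Icc 0 (top n k h : ℝ) ∩ Set.Iio (threshold n k h p : ℝ),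
        respond (buyer n) pay v (F v) h p =
        ∫⁻ v in Set.Icc 0 (top n k h : ℝ) ∩ Set.Iio (threshold n k h p : ℝ),
          F v (h.extend p false) := by
      refine setLIntegral_congr_fun (measurableSet_Icc.inter measurableSet_Iio) fun v hv => ?_
      simp only [respond_buyer]
      rw [if_neg (not_le.2 hv.2)]
    rw [this, threshold, hl, if_neg Bool.false_ne_true]
    split_ifs with hp
    · subst hp
      simp only [thresh_zero, NNReal.coe_zero]
      have : (Set.Icc 0 (top n k h : ℝ) ∩ Set.Iio 0) = ∅ := by
        ext x; simp only [Set.mem_inter_iff, Set.mem_Icc, Set.mem_Iio, Set.mem_empty_iff_false]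
        constructor
        · rintro ⟨⟨_, _⟩, _⟩; linarith
        · simp
      rw [this]
      simp
    · rw [top_extend, nextTop, if_neg hp, NNReal.coe_min]
      exact setLIntegral_congr (Icc_inter_Iio_ae_eq _ _)

/-- The revenue of any price before the first acceptance. -/
lemma lintegral_respond_le (S : SellerStrategy) (n m : ℕ) {k : ℕ} (hk : k + (m + 1) = n)
    (h : Hist k) (hl : locked k h = false) (p : ℝ≥0)
    (ih : ∫⁻ v in Set.Icc 0 (top n (k + 1) (h.extend p false) : ℝ),
        total S (buyer n) pay v m (h.extend p false) ≤
      ENNReal.ofReal ((top n (k + 1) (h.extend p false) : ℝ) ^ 2 * rev m)) :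
    ∫⁻ v in Set.Icc 0 (top n k h : ℝ),
        respond (buyer n) pay v (total S (buyer n) pay v m) h p ≤
      ENNReal.ofReal ((top n k h : ℝ) ^ 2 * rev (m + 1)) := by
  set b := top n k h with hb
  have hm : n - (k + 1) = m := by omega
  have ht : threshold n k h p = thresh m b p := by
    rw [threshold, hl, if_neg (by simp), hm]
  rw [top_extend, hm, ← hb] at ih
  rw [lintegral_respond n h hl, ← hb, top_extend, hm, ← hb, ht]
  have h1 : ∫⁻ v in Set.Icc (thresh m b p : ℝ) b,
      (p + total S (buyer n) pay v m (h.extend p true)) ≤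
      ENNReal.ofReal ((m + 1) * p * max ((b : ℝ) - thresh m b p) 0) := by
    calc _ ≤ ∫⁻ v in Set.Icc (thresh m b p : ℝ) b, ENNReal.ofReal ((m + 1) * p) := by
          refine setLIntegral_mono measurable_const fun v hv => ?_
          have hv1 : v ≤ 1 := hv.2.trans (NNReal.coe_le_coe.2 (top_le_one n k h))
          have h2 := total_pay_le_cap S n hv1 m (h.extend p true)
          rw [cap_extend_true] at h2
          have h3 : (m : ℝ≥0∞) * (min (cap k h) p : ℝ≥0) ≤ m * p := by
            gcongr; exact min_le_right _ _
          refine (add_le_add_right (h2.trans h3) _).trans (le_of_eq ?_)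
          rw [ENNReal.ofReal_mul (by positivity), ENNReal.ofReal_add (by positivity) one_pos.le]
          simp
          ring
      _ = _ := by
          rw [setLIntegral_const, Real.volume_Icc, ← ENNReal.ofReal_mul (by positivity)]
          rcases le_total (b : ℝ) (thresh m b p) with h2 | h2
          · rw [max_eq_right (by linarith), mul_zero, ENNReal.ofReal_zero,
              ENNReal.ofReal_eq_zero]
            exact mul_nonpos_of_nonneg_of_nonpos (by positivity) (by linarith)
          · rw [max_eq_left (by linarith)]
  have hr := rev_le_rev_succ m
  have hr0 : (0 : ℝ) ≤ rev m := by positivity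
  rcases eq_or_ne p 0 with rfl | hp
  -- At price 0 the bound `h1` is 0 and the rejection term is absent.
  · refine (add_le_add_left h1 _).trans ?_
    simp
  rw [if_neg hp]
  refine (add_le_add h1 ih).trans ?_
  rw [← ENNReal.ofReal_add (by positivity) (by positivity)]
  apply ENNReal.ofReal_le_ofReal
  rw [nextTop, if_neg hp, NNReal.coe_min]
  rcases thresh_cases m b p with ⟨h2, h3⟩ | ⟨h2, h3⟩
  · rw [← h3, min_eq_right h2, max_eq_left (by linarith)]
    exact revenue_le m b _
  -- Almost no believed type accepts, so a round is wasted; `rev` is monotone.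
  · rw [min_eq_left h2, max_eq_right (by linarith), mul_zero, zero_add]
    gcongr

/-- Before the first acceptance, no strategy of the seller earns more than the claimed revenue. -/
lemma lintegral_total_le (S : SellerStrategy) (n m : ℕ) {k : ℕ} (hk : k + m = n)
    (h : Hist k) (hl : locked k h = false) :
    ∫⁻ v in Set.Icc 0 (top n k h : ℝ), total S (buyer n) pay v m h ≤
      ENNReal.ofReal ((top n k h : ℝ) ^ 2 * rev m) := by
  induction m generalizing k with
  | zero => simp [total]
  | succ m ih =>
    have : IsMarkovKernel (S.price k) := S.markov k
    simp only [total]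
    -- A randomized price yields an average of the revenues of fixed prices, each bounded by
    -- `lintegral_respond_le`.
    rw [lintegral_lintegral_swap]
    · refine (lintegral_mono
        (g := fun _ => ENNReal.ofReal ((top n k h : ℝ) ^ 2 * rev (m + 1))) fun p => ?_).trans
        (by simp)
      exact lintegral_respond_le S n m hk h hl p (ih (by omega) _ (by simp [hl]))
    · refine Measurable.aemeasurable ?_
      have hx : Measurable fun x : ℝ × ℝ≥0 => (x.1, h, x.2) := by fun_prop
      exact (measurable_respond (buyer n) measurable_pay (F := fun v => total S (buyer n) pay v m)
        (measurable_total S (buyer n) measurable_pay m)).comp hx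

/-- The equilibrium strategy earns the claimed revenue. -/
lemma lintegral_total_seller (n m : ℕ) {k : ℕ} (hk : k + m = n)
    (h : Hist k) (hl : locked k h = false) :
    ∫⁻ v in Set.Icc 0 (top n k h : ℝ), total (seller n) (buyer n) pay v m h =
      ENNReal.ofReal ((top n k h : ℝ) ^ 2 * rev m) := by
  induction m generalizing k with
  | zero => simp [total, rev]
  | succ m ih =>
    set b := top n k h with hb
    set p := offer n k h with hp
    have hm : n - (k + 1) = m := by omega
    have hpq : p = quote (m + 1) b := by
      rw [hp, offer, hl, if_neg (by simp), hb]
      congr 1; omega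
    have hb0 : 0 < b := top_pos n k h
    have hb1 : (b : ℝ) ≤ 1 := NNReal.coe_le_coe.2 (top_le_one n k h)
    have hf0 := frac_pos m
    have ht : threshold n k h p = frac m * b := by
      rw [threshold, hl, if_neg (by simp), hm, ← hb, hpq, thresh_quote]
    have hpt : (p : ℝ) ≤ frac m * b := by
      have := le_threshold n k h p
      rw [ht] at this
      exact_mod_cast this
    have hfb : (frac m : ℝ) * b ≤ b := mul_le_of_le_one_left hb0.le (frac_le_one m)
    have htop : top n (k + 1) (h.extend p false) = frac m * b := by
      rw [top_extend, hm, ← hb, hpq, nextTop_quote hb0]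
    have hmp : (m + 1) * (p : ℝ) = frac m * b * (1 + 2 * rev m) := by
      rw [hpq, mul_quote, two_mul_rev_succ]; ring
    have hp0 : p ≠ 0 := by
      intro h0
      rw [h0] at hmp
      have : 0 < (frac m : ℝ) * b * (1 + 2 * rev m) := by
        have : (0 : ℝ) < b := hb0
        positivity
      simp [← hmp] at this
    have := ih (by omega) (h.extend p false) (by simp [hl])
    rw [htop] at this
    simp only [total_seller, ← hp]
    rw [lintegral_respond n h hl, if_neg hp0, htop, this, ht, ← hb]
    have h1 : ∫⁻ v in Set.Icc ((frac m * b : ℝ≥0) : ℝ) b,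
        (p + total (seller n) (buyer n) pay v m (h.extend p true)) =
        ENNReal.ofReal ((m + 1) * p * (b - frac m * b)) := by
      calc _ = ∫⁻ v in Set.Icc ((frac m * b : ℝ≥0) : ℝ) b, ENNReal.ofReal ((m + 1) * p) := by
            refine setLIntegral_congr_fun measurableSet_Icc fun v hv => ?_
            have hc : cap (k + 1) (h.extend p true) = p := by
              rw [cap_extend_true, cap_of_not_locked k h hl, min_eq_right]
              rw [← NNReal.coe_le_coe]
              exact hpt.trans (hfb.trans hb1)
            have h2 := total_pay_eq_cap n (v := v) m (h.extend p true) (by simp)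
              (by rw [hc]; exact hpt.trans (by simpa using hv.1))
            simp only [h2, hc]
            rw [ENNReal.ofReal_mul (by positivity), ENNReal.ofReal_add (by positivity) one_pos.le]
            simp
            ring
        _ = _ := by
            rw [setLIntegral_const, Real.volume_Icc, ← ENNReal.ofReal_mul (by positivity)]
            push_cast; rfl
    rw [h1, ← ENNReal.ofReal_add]
    · rw [hmp, ← revenue_eq]; push_cast; rfl
    · exact mul_nonneg (by positivity) (by linarith)
    · positivity

/-! ### Beliefs -/

/-- The equilibrium beliefs of the seller in the game with `n` rounds: uniform distributions, with
the mass moved to `1` after an acceptance of probability zero. -/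
noncomputable def belief (n : ℕ) : BeliefSystem
  | 0, _ => cond volume (Set.Icc 0 1)
  | k + 1, h =>
    -- After an acceptance every further reaction to an allowed price is certain under the belief,
    -- so nothing is learned; contrary reactions leave the belief alone.
    if locked k h.init then belief n k h.init
    else if (h (Fin.last k)).2 then
      if threshold n k h.init (h (Fin.last k)).1 < top n k h.init then
        cond volume (Set.Icc (threshold n k h.init (h (Fin.last k)).1 : ℝ) (top n k h.init))
      -- The interval is null here, so Bayes' rule is silent. The point mass at 1 is at least `cap`,
      -- which keeps freezing the price optimal.
      else Measure.dirac 1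
    else cond volume (Set.Icc 0 (top n (k + 1) h : ℝ))

lemma belief_of_not_locked (n : ℕ) : ∀ k (h : Hist k), locked k h = false →
    belief n k h = cond volume (Set.Icc 0 (top n k h : ℝ))
  | 0, _, _ => by simp [belief, top]
  | k + 1, h, hl => by
    simp only [locked, Bool.or_eq_false_iff] at hl
    rw [belief, hl.1, hl.2, if_neg Bool.false_ne_true, if_neg Bool.false_ne_true]

lemma belief_extend_of_locked (n : ℕ) {k : ℕ} (h : Hist k) (p : ℝ≥0) (b : Bool)
    (hl : locked k h = true) : belief n (k + 1) (h.extend p b) = belief n k h := by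
  rw [belief, Hist.init_extend, if_pos hl]

lemma belief_extend_true (n : ℕ) {k : ℕ} (h : Hist k) (p : ℝ≥0) (hl : locked k h = false) :
    belief n (k + 1) (h.extend p true) = if threshold n k h p < top n k h then
      cond volume (Set.Icc (threshold n k h p : ℝ) (top n k h)) else Measure.dirac 1 := by
  rw [belief, Hist.init_extend, hl, Hist.extend_last, if_neg Bool.false_ne_true, if_pos rfl]

lemma isProbabilityMeasure_cond_Icc {a b : ℝ} (h : a < b) :
    IsProbabilityMeasure (cond volume (Set.Icc a b)) := by
  apply cond_isProbabilityMeasure_of_finite <;> simp [h]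

lemma ae_cond_Icc (a b : ℝ) : ∀ᵐ v ∂(cond volume (Set.Icc a b)), a ≤ v ∧ v ≤ b := by
  filter_upwards [ae_cond_mem (μ := volume) (measurableSet_Icc (a := a) (b := b))] with v hv
  exact hv

/-- Beliefs are probability distributions on `[0, 1]`, and on `[cap, 1]` after an acceptance. -/
lemma belief_support (n : ℕ) : ∀ k (h : Hist k), IsProbabilityMeasure (belief n k h) ∧
    ∀ᵐ v ∂(belief n k h), 0 ≤ v ∧ v ≤ 1 ∧ (locked k h = true → (cap k h : ℝ) ≤ v)
  | 0, h => by
    refine ⟨isProbabilityMeasure_cond_Icc one_pos, ?_⟩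
    filter_upwards [ae_cond_Icc 0 1] with v hv
    exact ⟨hv.1, hv.2, by simp [locked]⟩
  | k + 1, h => by
    have ih := belief_support n k h.init
    have ht1 : (top n k h.init : ℝ) ≤ 1 := NNReal.coe_le_coe.2 (top_le_one n k h.init)
    have hcap : cap (k + 1) h ≤ cap k h.init := by
      rw [cap]; split_ifs
      · exact min_le_left _ _
      · exact le_rfl
    cases hl : locked k h.init with
    | true =>
      have e : belief n (k + 1) h = belief n k h.init := by rw [belief, if_pos hl]
      rw [e]
      refine ⟨ih.1, ?_⟩
      filter_upwards [ih.2] with v hv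
      exact ⟨hv.1, hv.2.1, fun _ => (NNReal.coe_le_coe.2 hcap).trans (hv.2.2 hl)⟩
    | false =>
      cases hb : (h (Fin.last k)).2 with
      | false =>
        have hl' : locked (k + 1) h = false := by rw [locked, hl, hb]; rfl
        rw [belief_of_not_locked n _ h hl']
        refine ⟨isProbabilityMeasure_cond_Icc (top_pos n _ h), ?_⟩
        filter_upwards [ae_cond_Icc 0 (top n (k + 1) h)] with v hv
        exact ⟨hv.1, hv.2.trans (NNReal.coe_le_coe.2 (top_le_one n _ h)), by simp [hl']⟩
      | true =>
        rw [belief, hl, hb, if_neg Bool.false_ne_true, if_pos rfl]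
        split_ifs with hlt
        · refine ⟨isProbabilityMeasure_cond_Icc hlt, ?_⟩
          filter_upwards [ae_cond_Icc (threshold n k h.init (h (Fin.last k)).1 : ℝ)
            (top n k h.init)] with v hv
          refine ⟨(NNReal.coe_nonneg _).trans hv.1, hv.2.trans ht1, fun _ => ?_⟩
          refine le_trans (NNReal.coe_le_coe.2 ?_) hv.1
          rw [cap, hb, if_pos rfl]
          exact (min_le_right _ _).trans (le_threshold _ _ _ _)
        · refine ⟨inferInstance, ?_⟩
          rw [ae_dirac_eq]
          exact ⟨zero_le_one, le_rfl, fun _ => NNReal.coe_le_coe.2 (cap_le_one _ h)⟩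

instance (n k : ℕ) (h : Hist k) : IsProbabilityMeasure (belief n k h) := (belief_support n k h).1

/-! ### Bayes' rule -/

/-- Bayes' rule for a reaction that reveals exactly whether the value belongs to `A`. -/
lemma bayes_eq_cond (μ : Measure ℝ) {A : Set ℝ} (hA : MeasurableSet A) {f : ℝ → ℝ≥0∞}
    (hf : f = A.indicator 1) :
    (∫⁻ v, f v ∂μ)⁻¹ • μ.withDensity f = cond μ A ∧ ∫⁻ v, f v ∂μ = μ A := by
  have h : ∫⁻ v, f v ∂μ = μ A := by rw [hf, lintegral_indicator_one hA]
  refine ⟨?_, h⟩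
  rw [h, hf, withDensity_indicator_one hA]
  rfl

lemma cond_eq_self_of_ae {μ : Measure ℝ} [IsProbabilityMeasure μ] {A : Set ℝ}
    (h : ∀ᵐ v ∂μ, v ∈ A) : cond μ A = μ := by
  have h1 : μ A = 1 := (measure_congr (eventuallyEq_univ.2 h)).trans measure_univ
  have h2 : μ.restrict A = μ := Measure.restrict_eq_self_of_ae_mem h
  rw [ProbabilityTheory.cond, h1, h2, inv_one, one_smul]

lemma buyer_prob_true_eq_indicator (n : ℕ) {k : ℕ} (h : Hist k) (p : ℝ≥0) :
    (fun v => (buyer n).prob true v h p) = (Set.Ici (threshold n k h p : ℝ)).indicator 1 := by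
  ext v
  rw [buyer_prob_true, Set.indicator_apply]
  rfl

lemma buyer_prob_false_eq_indicator (n : ℕ) {k : ℕ} (h : Hist k) (p : ℝ≥0) :
    (fun v => (buyer n).prob false v h p) = (Set.Iio (threshold n k h p : ℝ)).indicator 1 := by
  ext v
  rw [buyer_prob_false, Set.indicator_apply]
  rfl

lemma cond_cond_Icc {a b : ℝ} {A : Set ℝ} (hA : MeasurableSet A) :
    cond (cond volume (Set.Icc a b)) A = cond volume (Set.Icc a b ∩ A) :=
  cond_cond_eq_cond_inter' measurableSet_Icc hA (by simp)

lemma cond_congr_set {μ : Measure ℝ} {s t : Set ℝ} (h : s =ᵐ[μ] t) : cond μ s = cond μ t := by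
  rw [ProbabilityTheory.cond, ProbabilityTheory.cond, measure_congr h, Measure.restrict_congr_set h]

/-- After an acceptance, a reaction to an allowed price is certain. -/
lemma bayes_of_locked (n : ℕ) {k : ℕ} (h : Hist k) (hl : locked k h = true) (p : ℝ≥0)
    (hp : Allowed h p) {A : Set ℝ}
    (hA : A = Set.Ici (threshold n k h p : ℝ) ∨ A = Set.Iio (threshold n k h p : ℝ))
    (h0 : belief n k h A ≠ 0) : cond (belief n k h) A = belief n k h := by
  have ht : threshold n k h p = p := by rw [threshold, if_pos hl]
  rw [ht] at hA
  have hs := (belief_support n k h).2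
  apply cond_eq_self_of_ae
  rcases le_or_gt p 1 with hp1 | hp1
  -- An allowed price up to 1 is at most `cap` and is surely accepted; a price above 1 is surely
  -- rejected.
  · have hpc : (p : ℝ) ≤ cap k h := NNReal.coe_le_coe.2 (le_cap k h p hp hp1)
    rcases hA with rfl | rfl
    · filter_upwards [hs] with v hv using hpc.trans (hv.2.2 hl)
    · refine absurd (measure_eq_zero_iff_ae_notMem.2 ?_) h0
      filter_upwards [hs] with v hv using not_lt.2 (hpc.trans (hv.2.2 hl))
  · have hp1' : (1 : ℝ) < p := hp1
    rcases hA with rfl | rfl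
    · refine absurd (measure_eq_zero_iff_ae_notMem.2 ?_) h0
      filter_upwards [hs] with v hv using not_le.2 (hv.2.1.trans_lt hp1')
    · filter_upwards [hs] with v hv using hv.2.1.trans_lt hp1'

lemma bayes_accept (n : ℕ) {k : ℕ} (h : Hist k) (p : ℝ≥0) (hp : Allowed h p)
    (h0 : belief n k h (Set.Ici (threshold n k h p : ℝ)) ≠ 0) :
    belief n (k + 1) (h.extend p true) =
      cond (belief n k h) (Set.Ici (threshold n k h p : ℝ)) := by
  cases hl : locked k h with
  | true => rw [belief_extend_of_locked n h p _ hl, bayes_of_locked n h hl p hp (.inl rfl) h0]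
  | false =>
    have e : Set.Icc 0 (top n k h : ℝ) ∩ Set.Ici (threshold n k h p : ℝ) =
        Set.Icc (threshold n k h p : ℝ) (top n k h) := by
      ext x
      simp only [Set.mem_inter_iff, Set.mem_Icc, Set.mem_Ici]
      exact ⟨fun hx => ⟨hx.2, hx.1.2⟩,
        fun hx => ⟨⟨(NNReal.coe_nonneg _).trans hx.1, hx.2⟩, hx.1⟩⟩
    rw [belief_of_not_locked n k h hl] at h0 ⊢
    rw [belief_extend_true n h p hl, cond_cond_Icc measurableSet_Ici, e, if_pos]
    by_contra hlt
    apply h0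
    have hle : (top n k h : ℝ) - threshold n k h p ≤ 0 :=
      sub_nonpos.2 (NNReal.coe_le_coe.2 (not_lt.1 hlt))
    rw [cond_apply measurableSet_Icc, e, Real.volume_Icc (a := (threshold n k h p : ℝ)),
      ENNReal.ofReal_eq_zero.2 hle, mul_zero]

lemma bayes_reject (n : ℕ) {k : ℕ} (h : Hist k) (p : ℝ≥0) (hp : Allowed h p)
    (h0 : belief n k h (Set.Iio (threshold n k h p : ℝ)) ≠ 0) :
    belief n (k + 1) (h.extend p false) =
      cond (belief n k h) (Set.Iio (threshold n k h p : ℝ)) := by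
  cases hl : locked k h with
  | true => rw [belief_extend_of_locked n h p _ hl, bayes_of_locked n h hl p hp (.inr rfl) h0]
  | false =>
    have ht : threshold n k h p = thresh (n - (k + 1)) (top n k h) p := by
      rw [threshold, hl, if_neg Bool.false_ne_true]
    rcases eq_or_ne p 0 with rfl | hp0
    · refine absurd (measure_eq_zero_iff_ae_notMem.2 ?_) h0
      rw [ht, thresh_zero]
      filter_upwards [(belief_support n k h).2] with v hv using not_lt.2 hv.1
    · rw [belief_of_not_locked n k h hl, belief_of_not_locked n (k + 1) _ (by simp [hl]),
        cond_cond_Icc measurableSet_Iio, top_extend, nextTop, if_neg hp0, ht, NNReal.coe_min]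
      exact (cond_congr_set (Icc_inter_Iio_ae_eq _ _)).symm

/-! ### The equilibrium -/

lemma lintegral_belief (n : ℕ) {k : ℕ} (h : Hist k) (hl : locked k h = false) (f : ℝ → ℝ≥0∞) :
    ∫⁻ v, f v ∂(belief n k h) =
      (volume (Set.Icc 0 (top n k h : ℝ)))⁻¹ * ∫⁻ v in Set.Icc 0 (top n k h : ℝ), f v := by
  rw [belief_of_not_locked n k h hl, ProbabilityTheory.cond, lintegral_smul_measure, smul_eq_mul]

lemma sellerUtility_le (S : SellerStrategy) {n k : ℕ} (hk : k < n) (h : Hist k) :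
    sellerUtility S (buyer n) (belief n k h) (n - k) h ≤
      sellerUtility (seller n) (buyer n) (belief n k h) (n - k) h := by
  unfold sellerUtility
  cases hl : locked k h with
  | true =>
    refine lintegral_mono_ae ?_
    filter_upwards [(belief_support n k h).2] with v hv
    exact total_pay_le_seller S n _ h hl (hv.2.2 hl) hv.2.1
  | false =>
    rw [lintegral_belief n h hl, lintegral_belief n h hl,
      lintegral_total_seller n (n - k) (by omega) h hl]
    gcongr
    exact lintegral_total_le S n (n - k) (by omega) h hl

/-- With the current price fixed, the strategies differ only in the continuation. Optimality is
checked type by type after an acceptance, and in integrated form after a rejection. -/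
lemma sellerUtilityMid_le (S : SellerStrategy) {n k : ℕ} (hk : k < n) (h : Hist k)
    (p : ℝ≥0) :
    sellerUtilityMid S (buyer n) (belief n k h) (n - (k + 1)) h p ≤
      sellerUtilityMid (seller n) (buyer n) (belief n k h) (n - (k + 1)) h p := by
  unfold sellerUtilityMid
  cases hl : locked k h with
  | true =>
    refine lintegral_mono_ae ?_
    filter_upwards [(belief_support n k h).2] with v hv
    have hc := hv.2.2 hl
    rw [respond_buyer, respond_buyer]
    split_ifs with h1
    · gcongr
      refine total_pay_le_seller S n _ _ (by simp) ?_ hv.2.1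
      rw [cap_extend_true]
      exact (NNReal.coe_le_coe.2 (min_le_left _ _)).trans hc
    · exact total_pay_le_seller S n _ _ (by simp [hl]) (by simpa using hc) hv.2.1
  | false =>
    rw [lintegral_belief n h hl, lintegral_belief n h hl, lintegral_respond n h hl,
      lintegral_respond n h hl]
    refine mul_le_mul' le_rfl (add_le_add ?_ ?_)
    · refine setLIntegral_mono' measurableSet_Icc fun v hv => ?_
      gcongr
      refine total_pay_le_seller S n _ _ (by simp) ?_
        (hv.2.trans (NNReal.coe_le_coe.2 (top_le_one n k h)))
      refine le_trans (NNReal.coe_le_coe.2 ?_) hv.1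
      rw [cap_extend_true]
      exact (min_le_right _ _).trans (le_threshold _ _ _ _)
    · split_ifs
      · exact le_rfl
      · rw [lintegral_total_seller n _ (by omega) _ (by simp [hl])]
        exact lintegral_total_le S n _ (by omega) _ (by simp [hl])

lemma belief_root_eq (n : ℕ) : belief n 0 Hist.root = unif := by
  simp [belief, ProbabilityTheory.cond, unif]

theorem isPBE (n : ℕ) :
    IsPBE n (Set.Icc 0 1) unif (seller n) (buyer n) (belief n) where
  belief_prob k _ h _ := by
    refine ⟨inferInstance, measure_eq_zero_iff_ae_notMem.2 ?_⟩
    filter_upwards [(belief_support n k h).2] with v hv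
    exact fun hv' => hv' ⟨hv.1, hv.2.1⟩
  belief_root := belief_root_eq n
  bayes k _ h _ p hp b h0 := by
    cases b with
    | true =>
      obtain ⟨e1, e2⟩ := bayes_eq_cond (belief n k h) measurableSet_Ici
        (buyer_prob_true_eq_indicator n h p)
      rw [e2] at h0
      rw [e1, bayes_accept n h p hp h0]
    | false =>
      obtain ⟨e1, e2⟩ := bayes_eq_cond (belief n k h) measurableSet_Iio
        (buyer_prob_false_eq_indicator n h p)
      rw [e2] at h0
      rw [e1, bayes_reject n h p hp h0]
  seller_opt _ hk h _ S := sellerUtility_le S hk h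
  seller_opt_mid _ hk h _ p _ S := sellerUtilityMid_le S hk h p
  buyer_opt _ hk h _ _ hv B := buyerUtility_le n B hv.1 hv.2 hk h
  buyer_opt_mid _ hk h _ p _ _ hv B := buyerUtilityMid_le n B hv.1 hv.2 hk h p

/-- The equilibrium revenue. -/
lemma sellerUtility_root (n : ℕ) :
    sellerUtility (seller n) (buyer n) unif n Hist.root = ENNReal.ofReal (rev n) := by
  have := lintegral_total_seller n n (k := 0) (by omega) Hist.root rfl
  simpa [top, sellerUtility, unif] using this

/-! ### Asymptotics -/

/-- The square of the revenue plus one. -/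
noncomputable def sqRev (n : ℕ) : ℝ := (1 + (rev n : ℝ)) ^ 2

/-- Squaring `1 + R' = (1 + R) + 1/(4(1 + R))` makes the leading growth linear. -/
lemma sqRev_succ (n : ℕ) : sqRev (n + 1) = sqRev n + 1 / 2 + 1 / (16 * sqRev n) := by
  have : (0 : ℝ) < 1 + (rev n : ℝ) := by positivity
  rw [sqRev, one_add_rev_succ, sqRev]
  field_simp
  ring

lemma one_add_half_le_sqRev (n : ℕ) : 1 + (n : ℝ) / 2 ≤ sqRev n := by
  induction n with
  | zero => simp [sqRev, rev]
  | succ n ih =>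
    rw [sqRev_succ]
    have : 0 < 1 / (16 * sqRev n) := by
      have : (0 : ℝ) ≤ n := by positivity
      have : 0 < sqRev n := by linarith
      positivity
    push_cast
    linarith

lemma sqRev_pos (n : ℕ) : 0 < sqRev n := by
  have := one_add_half_le_sqRev n
  have : (0 : ℝ) ≤ n := by positivity
  linarith

lemma one_div_sqRev_le (n : ℕ) : 1 / sqRev n ≤ 2 / ((n : ℝ) + 2) := by
  rw [div_le_div_iff₀ (sqRev_pos n) (by positivity)]
  linarith [one_add_half_le_sqRev n]

/-- The linear lower bound turns each correction into at most `1/(8(n+2))`, which is dominated by an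
increment of `log(n+1)/8`. -/
lemma sqRev_le (n : ℕ) : sqRev n ≤ 1 + n / 2 + Real.log (n + 1) / 8 := by
  induction n with
  | zero => simp [sqRev, rev]
  | succ n ih =>
    have h1 := one_div_sqRev_le n
    have h2 : 1 / ((n : ℝ) + 2) ≤ Real.log (n + 2) - Real.log (n + 1) := by
      have h3 := Real.log_le_sub_one_of_pos (x := ((n : ℝ) + 1) / (n + 2)) (by positivity)
      rw [Real.log_div (by positivity) (by positivity)] at h3
      have h4 : ((n : ℝ) + 1) / (n + 2) - 1 = - (1 / ((n : ℝ) + 2)) := by field_simp; ring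
      linarith
    have h3 : 1 / (16 * sqRev n) = 1 / 16 * (1 / sqRev n) := by rw [one_div_mul_one_div]
    have h4 : 2 / ((n : ℝ) + 2) = 2 * (1 / ((n : ℝ) + 2)) := by ring
    rw [sqRev_succ, h3]
    push_cast
    rw [show (n : ℝ) + 1 + 1 = n + 2 by ring]
    linarith

/-- Subtracting `log x / 8` cancels the correction `1/(16x)` to first order: `log(x'/x) ≤ x'/x - 1`
leaves a loss of at most `1/(128x²)` per step. As `1/x² ≤ 4(1/(n+1) - 1/(n+2))`, the losses
telescope to the `1/32` term. -/
lemma le_sqRev_sub_log (n : ℕ) :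
    1 + (n : ℝ) / 2 - 1 / 32 * (1 - 1 / (n + 1)) ≤ sqRev n - Real.log (sqRev n) / 8 := by
  induction n with
  | zero => simp [sqRev, rev]
  | succ n ih =>
    have hp := sqRev_pos n
    have hp' := sqRev_pos (n + 1)
    have h1 : Real.log (sqRev (n + 1)) ≤ Real.log (sqRev n) +
        (1 / 2 * (1 / sqRev n) + 1 / 16 * (1 / sqRev n) ^ 2) := by
      have h3 := Real.log_le_sub_one_of_pos (x := sqRev (n + 1) / sqRev n) (by positivity)
      rw [Real.log_div hp'.ne' hp.ne'] at h3
      have h4 : sqRev (n + 1) / sqRev n - 1 = 1 / 2 * (1 / sqRev n) + 1 / 16 * (1 / sqRev n) ^ 2 := by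
        rw [sqRev_succ]; field_simp; ring
      linarith
    have h2 : (1 / sqRev n) ^ 2 ≤ 4 * (1 / ((n : ℝ) + 1) - 1 / (n + 2)) := by
      calc (1 / sqRev n) ^ 2 ≤ (2 / ((n : ℝ) + 2)) ^ 2 := by
            have := one_div_sqRev_le n
            gcongr
        _ ≤ 4 * (1 / ((n : ℝ) + 1) - 1 / (n + 2)) := by
            have h0 : (0 : ℝ) ≤ n := by positivity
            rw [div_sub_div _ _ (by positivity) (by positivity), div_pow, ← mul_div_assoc,
              div_le_div_iff₀ (by positivity) (by positivity)]
            nlinarith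
    have h3 : 1 / (16 * sqRev n) = 1 / 16 * (1 / sqRev n) := by rw [one_div_mul_one_div]
    rw [sqRev_succ n, h3] at h1 ⊢
    push_cast
    rw [show (n : ℝ) + 1 + 1 = n + 2 by ring]
    linarith

/-! ### Bounded error term and limits -/

/-- The error term in the revenue. -/
noncomputable def err (n : ℕ) : ℝ := sqRev n - n / 2 - Real.log n / 8

/-- Replacing `log(n+1)` in the upper bound, and `log (sqRev n) ≥ log(n/2)` in the lower one, by
`log n` costs at most `log 2 / 8` each. -/
lemma abs_err_le {n : ℕ} (hn : 1 ≤ n) : |err n| ≤ 2 := by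
  have hn' : (1 : ℝ) ≤ n := by exact_mod_cast hn
  have hlog2 : Real.log 2 ≤ 1 := by linarith [Real.log_le_sub_one_of_pos (x := 2) (by norm_num)]
  have h1 := sqRev_le n
  have h2 := le_sqRev_sub_log n
  have h3 : Real.log (n + 1) ≤ Real.log 2 + Real.log n := by
    rw [← Real.log_mul (by norm_num) (by positivity)]
    exact Real.log_le_log (by positivity) (by linarith)
  have h4 : Real.log n - Real.log 2 ≤ Real.log (sqRev n) := by
    rw [← Real.log_div (by positivity) (by norm_num)]
    exact Real.log_le_log (by positivity) (by linarith [one_add_half_le_sqRev n])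
  have h5 : 0 ≤ 1 / ((n : ℝ) + 1) := by positivity
  rw [abs_le, err]
  constructor <;> linarith

lemma add_err (n : ℕ) : (n : ℝ) / 2 + Real.log n / 8 + err n = sqRev n := by
  unfold err; ring

lemma rev_eq_sqrt (n : ℕ) : (rev n : ℝ) = √((n : ℝ) / 2 + Real.log n / 8 + err n) - 1 := by
  rw [add_err, sqRev, Real.sqrt_sq (by positivity)]
  ring

lemma tendsto_sqRev_div : Tendsto (fun n : ℕ => sqRev n / ((n : ℝ) / 2)) atTop (𝓝 1) := by
  have hlog : Tendsto (fun n : ℕ => Real.log n / n) atTop (𝓝 0) :=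
    (Real.isLittleO_log_id_atTop.tendsto_div_nhds_zero).comp tendsto_natCast_atTop_atTop
  have hinv : Tendsto (fun n : ℕ => 4 / (n : ℝ)) atTop (𝓝 0) :=
    tendsto_const_nhds.div_atTop tendsto_natCast_atTop_atTop
  have hupper : Tendsto (fun n : ℕ => 1 + (Real.log n / n) / 4 + 4 / (n : ℝ)) atTop (𝓝 1) := by
    simpa using ((tendsto_const_nhds (x := (1 : ℝ))).add (hlog.div_const 4)).add hinv
  refine tendsto_of_tendsto_of_tendsto_of_le_of_le' tendsto_const_nhds hupper ?_ ?_
  · filter_upwards [eventually_ge_atTop 1] with n hn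
    have hn' : (0 : ℝ) < n := by exact_mod_cast hn
    rw [le_div_iff₀ (by positivity)]
    linarith [one_add_half_le_sqRev n]
  · filter_upwards [eventually_ge_atTop 1] with n hn
    have hn' : (0 : ℝ) < n := by exact_mod_cast hn
    have h1 := (abs_le.1 (abs_err_le hn)).2
    rw [div_le_iff₀ (by positivity), ← add_err]
    have : (1 + Real.log n / n / 4 + 4 / (n : ℝ)) * (n / 2) = n / 2 + Real.log n / 8 + 2 := by
      field_simp; ring
    linarith

lemma tendsto_rev_div :
    Tendsto (fun n : ℕ => (1 + (rev n : ℝ)) / √((n : ℝ) / 2)) atTop (𝓝 1) := by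
  have h := (Real.continuous_sqrt.tendsto 1).comp tendsto_sqRev_div
  rw [Real.sqrt_one] at h
  refine h.congr fun n => ?_
  rw [Function.comp_apply, Real.sqrt_div (sqRev_pos n).le, sqRev, Real.sqrt_sq (by positivity)]

lemma tendsto_sqrt_half : Tendsto (fun n : ℕ => √((n : ℝ) / 2)) atTop atTop :=
  Real.tendsto_sqrt_atTop.comp
    (tendsto_natCast_atTop_atTop.atTop_div_const (by norm_num : (0 : ℝ) < 2))

/-- The first price. -/
lemma isEquivalent_quote :
    (fun n : ℕ => (quote n 1 : ℝ)) ~[atTop] (fun n : ℕ => √(2 / (n : ℝ))) := by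
  have h1 : Tendsto (fun n : ℕ => (1 + (rev n : ℝ)) / √((n : ℝ) / 2) - 1 / √((n : ℝ) / 2))
      atTop (𝓝 1) := by
    have h := tendsto_rev_div.sub
      ((tendsto_const_nhds (x := (1 : ℝ))).div_atTop tendsto_sqrt_half)
    rwa [sub_zero] at h
  refine isEquivalent_of_tendsto_one (h1.congr' ?_)
  filter_upwards [eventually_ge_atTop 1] with n hn
  have hn' : (0 : ℝ) < n := by exact_mod_cast hn
  have hs : √((n : ℝ) / 2) * √((n : ℝ) / 2) = n / 2 := Real.mul_self_sqrt (by positivity)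
  have hs0 : 0 < √((n : ℝ) / 2) := Real.sqrt_pos.2 (by positivity)
  have h2 : √(2 / (n : ℝ)) = 1 / √((n : ℝ) / 2) := by
    rw [one_div, ← Real.sqrt_inv, inv_div]
  simp only [Pi.div_apply, quote, h2]
  push_cast
  field_simp
  rw [pow_two, hs]
  ring

/-- The first threshold. -/
lemma isEquivalent_one_sub_frac :
    (fun n : ℕ => 1 - (frac (n - 1) : ℝ)) ~[atTop] (fun n : ℕ => 1 / √(2 * (n : ℝ))) := by
  -- The index shift is absorbed by squeezing: `n/2 ≤ 1 + (n-1)/2 ≤ sqRev (n - 1)` from below,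
  -- monotonicity of `rev` from above.
  have h1 : Tendsto (fun n : ℕ => (1 + (rev (n - 1) : ℝ)) / √((n : ℝ) / 2)) atTop (𝓝 1) := by
    refine tendsto_of_tendsto_of_tendsto_of_le_of_le' tendsto_const_nhds tendsto_rev_div ?_ ?_
    · filter_upwards [eventually_ge_atTop 1] with n hn
      have hn' : (0 : ℝ) < n := by exact_mod_cast hn
      rw [one_le_div (Real.sqrt_pos.2 (by positivity)), Real.sqrt_le_left (by positivity)]
      have := one_add_half_le_sqRev (n - 1)
      rw [Nat.cast_sub hn] at this
      push_cast at this
      rw [sqRev] at this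
      linarith
    · filter_upwards [eventually_ge_atTop 1] with n hn
      have := rev_le_rev_succ (n - 1)
      rw [Nat.sub_add_cancel hn] at this
      gcongr
  have h2 := h1.inv₀ one_ne_zero
  rw [inv_one] at h2
  refine isEquivalent_of_tendsto_one (h2.congr' ?_)
  filter_upwards [eventually_ge_atTop 1] with n hn
  have hn' : (0 : ℝ) < n := by exact_mod_cast hn
  have h3 : √(2 * (n : ℝ)) = 2 * √((n : ℝ) / 2) := by
    rw [show 2 * (n : ℝ) = 2 ^ 2 * (n / 2) by ring, Real.sqrt_mul (by norm_num),
      Real.sqrt_sq (by norm_num)]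
  have hs0 : 0 < √((n : ℝ) / 2) := Real.sqrt_pos.2 (by positivity)
  have : (0 : ℝ) < 1 + (rev (n - 1) : ℝ) := by positivity
  simp only [Pi.div_apply, one_sub_frac, h3]
  field_simp

lemma threshold_root {n : ℕ} (hn : 1 ≤ n) :
    (threshold n 0 Hist.root (quote n 1) : ℝ) = frac (n - 1) := by
  obtain ⟨m, rfl⟩ : ∃ m, n = m + 1 := ⟨n - 1, by omega⟩
  have h : threshold (m + 1) 0 Hist.root (quote (m + 1) 1) = thresh m 1 (quote (m + 1) 1) := rfl
  rw [h, thresh_quote, mul_one, Nat.add_sub_cancel]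

lemma price_root (n : ℕ) : (seller n).price 0 Hist.root = Measure.dirac (quote n 1) := by
  have h : offer n 0 Hist.root = quote n 1 := rfl
  rw [seller, Kernel.deterministic_apply, h]

end RepeatedSales

/-! ### The theorem -/

theorem theorem3 :
    ∃ (S : ℕ → SellerStrategy) (B : ℕ → BuyerStrategy) (μ : ℕ → BeliefSystem)
      (t : ℕ → ∀ k, Hist k → ℝ≥0 → ℝ≥0) (R : ℕ → ℝ) (p : ℕ → ℝ≥0) (e : ℕ → ℝ) (C : ℝ),
      -- the recursion
      R 0 = 0 ∧ (∀ n : ℕ, 1 ≤ n → R n = (1 + 2 * R (n - 1)) ^ 2 / (4 * (1 + R (n - 1)))) ∧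
      -- for every number of rounds, a threshold equilibrium with revenue `R n`
      (∀ n : ℕ, 1 ≤ n →
        IsPBE n (Set.Icc 0 1) unif (S n) (B n) (μ n) ∧
        IsThreshold (B n) (t n) ∧
        sellerUtility (S n) (B n) unif n Hist.root = ENNReal.ofReal (R n) ∧
        -- the asymptotics of the revenue, with a bounded error term `e n`
        |e n| ≤ C ∧
        0 ≤ (n : ℝ) / 2 + Real.log n / 8 + e n ∧
        R n = √((n : ℝ) / 2 + Real.log n / 8 + e n) - 1 ∧
        -- the price in the first round
        (S n).price 0 Hist.root = Measure.dirac (p n)) ∧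
      (fun n => (p n : ℝ)) ~[atTop] (fun n : ℕ => √(2 / (n : ℝ))) ∧
      -- the threshold in the first round, at that price
      (fun n => 1 - (t n 0 Hist.root (p n) : ℝ)) ~[atTop] (fun n : ℕ => 1 / √(2 * (n : ℝ))) := by
  refine ⟨seller, buyer, belief, threshold, fun n => rev n, fun n => quote n 1, err, 2,
    by simp [rev],
    fun n hn => ?_, fun n hn => ⟨isPBE n, isThreshold_buyer n, sellerUtility_root n,
      abs_err_le hn, ?_, rev_eq_sqrt n, price_root n⟩, isEquivalent_quote, ?_⟩
  · obtain ⟨m, rfl⟩ : ∃ m, n = m + 1 := ⟨n - 1, by omega⟩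
    exact coe_rev_succ m
  · rw [add_err]
    exact (sqRev_pos n).le
  · refine isEquivalent_one_sub_frac.congr_left ?_
    filter_upwards [eventually_ge_atTop 1] with n hn
    rw [threshold_root hn]
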